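/- Let $L>0$, $h\in\mathbb C$, and let $q:[0,L]\to\mathbb C$ belong to $W_2^1[0,L]$, i.e. $q$ is absolutely continuous with $q'\in L_2[0,L]$. For $\rho\in\mathbb C$ let $S(\rho,\cdot)$ and $\phi(\rho,\cdot)$ be the solutions of $-y''+q(x)y=\rho^2y$ on $(0,L)$ with $S(\rho,0)=0$, $S'(\rho,0)=1$ and $\phi(\rho,0)=1$, $\phi'(\rho,0)=h$. Put $$\omega(x)=\tfrac12\int_0^xq(s)\,ds,\qquad q^+(x)=\frac{q(x)+q(0)}4-\frac{\omega^2(x)}2,\qquad q^h(x)=\frac{q(x)-q(0)}4-\frac{\omega^2(x)}2-h\,\omega(x),$$ $\operatorname{sinc}(z)=\frac{\sin(\pi z)}{\pi z}$ for $z\ne0$, $\operatorname{sinc}(0)=1$, and $j_1(z)=\frac{\sin z}{z^2}-\frac{\cos z}{z}$ (spherical Bessel function of order $1$). Fix $x\in(0,L]$ and put $$\mathfrak s_n(x)=(-1)^{n+1}S\!\left(\tfrac{2n+1}{2x}\pi,x\right)\frac{((2n+1)\pi)^3}{4x^3}+2\left(\tfrac{2n+1}{2x}\pi\right)^2+2q^+(x),\quad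 n=0,1,\dots,$$ $$\Phi_n(x)=\left((-1)^n-\phi\!\left(\tfrac{n\pi}x,x\right)\right)\left(\tfrac{n\pi}x\right)^2+(-1)^nq^h(x),\quad n=1,2,\dots,$$ $$\sigma_n(\rho)=\operatorname{sinc}\!\left(\tfrac{2\rho x}\pi-2n-1\right)+\operatorname{sinc}\!\left(\tfrac{2\rho x}\pi+2n+1\right),\qquad \kappa_n(\rho)=\operatorname{sinc}\!\left(\tfrac{\rho x}\pi-n\right)+\operatorname{sinc}\!\left(\tfrac{\rho x}\pi+n\right).$$ Then: (1) For all $\rho\in\mathbb C\setminus\{0\}$ with $\sin(\rho x)\neq0$, $$S(\rho,x)=\frac{\sin(\rho x)}\rho-\frac{\cos(\rho x)}{\rho^2}\omega(x)+\frac{\sin(\rho x)}{\rho^3}q^+(x)-\frac1{2\rho^3\sin(\rho x)}\sum_{n=0}^\infty\mathfrak s_n(x)\,\sigma_n(\rho).$$ For every $\rho\ne0$ the same holds with the division by $2\sin(\rho x)$ carried out term by term, where $\sigma_n(\rho)/(2\sin(\rho x))$ is extended continuously to the zeros of $\sin(\rho x)$. As $\rho\to0$ the right-hand side tends to $S(0,x)$.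 (2) For all $\rho\in\mathbb C\setminus\{0\}$, $$\phi(\rho,x)=\cos(\rho x)+\frac{\sin(\rho x)}\rho\,(h+\omega(x))-\frac x\rho\,j_1(\rho x)\,q^h(x)-\frac1{\rho^2}\sum_{n=1}^\infty\Phi_n(x)\,\kappa_n(\rho),$$ and as $\rho\to0$ the right-hand side tends to $\phi(0,x)$. (3) Each of the three series $\sum_{n\ge0}\mathfrak s_n(x)\sigma_n(\rho)$, $\sum_{n\ge0}\mathfrak s_n(x)\frac{\sigma_n(\rho)}{2\sin(\rho x)}$ (with continuously extended terms) and $\sum_{n\ge1}\Phi_n(x)\kappa_n(\rho)$ converges uniformly on every compact subset of the complex $\rho$-plane; for $\rho\in\mathbb R$ it converges absolutely, uniformly on $\mathbb R$, and in the norm of $L_2(\mathbb R)$ (its terms and its sum being in $L_2(\mathbb R)$). -/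

import Mathlib

open Filter Topology MeasureTheory

noncomputable section

namespace SincSL

/-- The complex-valued Sobolev space `W₂¹[0,L]`, elements being given by their absolutely continuous
representative: `q` is the primitive on `[0,L]` of a function `g ∈ L₂[0,L]` (its derivative). -/
def MemW21 (L : ℝ) (q : ℝ → ℂ) : Prop :=
  ∃ g : ℝ → ℂ, MemLp g 2 (volume.restrict (Set.Icc 0 L)) ∧
    ∀ x ∈ Set.Icc 0 L, q x = q 0 + ∫ t in (0 : ℝ)..x, g t

/-- `y` is the (classical) solution of `-y'' + q y = ρ² y` on `(0,L)` which is continuously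
differentiable up to the end points and satisfies `y(0) = a`, `y'(0) = b`. -/
def IsSolution (L : ℝ) (q : ℝ → ℂ) (ρ a b : ℂ) (y : ℝ → ℂ) : Prop :=
  ∃ dy : ℝ → ℂ,
    ContinuousOn dy (Set.Icc 0 L) ∧
    (∀ x ∈ Set.Icc 0 L, HasDerivWithinAt y (dy x) (Set.Icc 0 L) x) ∧
    (∃ ddy : ℝ → ℂ, ∀ x ∈ Set.Ioo 0 L,
      HasDerivAt dy (ddy x) x ∧ -ddy x + q x * y x = ρ ^ 2 * y x) ∧
    y 0 = a ∧ dy 0 = b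

/-- `ω(x) = ½ ∫₀ˣ q`. -/
def omega (q : ℝ → ℂ) (x : ℝ) : ℂ := (1 / 2) * ∫ s in (0 : ℝ)..x, q s

/-- `q⁺(x) = (q(x) + q(0))/4 - ω(x)²/2`. -/
def qPlus (q : ℝ → ℂ) (x : ℝ) : ℂ := (q x + q 0) / 4 - omega q x ^ 2 / 2

/-- `qʰ(x) = (q(x) - q(0))/4 - ω(x)²/2 - h ω(x)`. -/
def qH (q : ℝ → ℂ) (h : ℂ) (x : ℝ) : ℂ :=
  (q x - q 0) / 4 - omega q x ^ 2 / 2 - h * omega q x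

/-- The normalized cardinal sine on the complex plane. -/
def csinc (z : ℂ) : ℂ :=
  if z = 0 then 1 else Complex.sin (Real.pi * z) / (Real.pi * z)

/-- The spherical Bessel function `j₁` (at `0` the right-hand side evaluates to the correct
value `0`). -/
def sphericalJ1 (z : ℂ) : ℂ := Complex.sin z / z ^ 2 - Complex.cos z / z

/-- The coefficient `𝔰ₙ(x)`, for `y = S(·,x)`. -/
def sCoeff (q : ℝ → ℂ) (S : ℂ → ℝ → ℂ) (x : ℝ) (n : ℕ) : ℂ :=
  (-1) ^ (n + 1) * S ((2 * n + 1) / (2 * x) * Real.pi) x * (((2 * n + 1) * Real.pi) ^ 3 / (4 * x ^ 3))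
    + 2 * ((2 * n + 1) / (2 * x) * Real.pi) ^ 2 + 2 * qPlus q x

/-- The coefficient `Φₙ(x)`. -/
def phiCoeff (q : ℝ → ℂ) (h : ℂ) (φ : ℂ → ℝ → ℂ) (x : ℝ) (n : ℕ) : ℂ :=
  ((-1) ^ n - φ (n * Real.pi / x) x) * (n * Real.pi / x) ^ 2 + (-1) ^ n * qH q h x

/-- `sinc(2ρx/π - 2n - 1) + sinc(2ρx/π + 2n + 1)`. -/
def sKernel (x : ℝ) (n : ℕ) (ρ : ℂ) : ℂ :=
  csinc (2 * ρ * x / Real.pi - 2 * n - 1) + csinc (2 * ρ * x / Real.pi + 2 * n + 1)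

/-- `sinc(ρx/π - n) + sinc(ρx/π + n)`. -/
def phiKernel (x : ℝ) (n : ℕ) (ρ : ℂ) : ℂ :=
  csinc (ρ * x / Real.pi - n) + csinc (ρ * x / Real.pi + n)

/-- `sKernel x n ρ / (2 sin(ρx))`, with its removable singularities (the zeros of `sin(ρx)`) filled
in by continuity. -/
def sKernelQuot (x : ℝ) (n : ℕ) (ρ : ℂ) : ℂ :=
  limUnder (𝓝[≠] ρ) fun z : ℂ => sKernel x n z / (2 * Complex.sin (z * x))

/-- The convergence properties of a series `∑ₙ f n ρ` of functions of `ρ`: uniform on every compact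
subset of the complex plane; on the real line absolute, uniform, and in the norm of `L₂(ℝ)`. -/
def ConvergesLikeCardinalSeries (f : ℕ → ℂ → ℂ) : Prop :=
  (∀ K : Set ℂ, IsCompact K →
    TendstoUniformlyOn (fun (N : ℕ) (ρ : ℂ) => ∑ n ∈ Finset.range N, f n ρ)
      (fun ρ => ∑' n, f n ρ) atTop K) ∧
  (∀ ρ : ℝ, Summable fun n => ‖f n ρ‖) ∧
  TendstoUniformly (fun (N : ℕ) (ρ : ℝ) => ∑ n ∈ Finset.range N, f n ρ)
    (fun ρ : ℝ => ∑' n, f n ρ) atTop ∧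
  (∀ n, MemLp (fun ρ : ℝ => f n ρ) 2 volume) ∧
  MemLp (fun ρ : ℝ => ∑' n, f n ρ) 2 volume ∧
  Tendsto (fun N : ℕ =>
      eLpNorm (fun ρ : ℝ => (∑ n ∈ Finset.range N, f n ρ) - ∑' n, f n ρ) 2 volume)
    atTop (𝓝 0)

/-- The cardinal series representation of `S(ρ,x)` (right-hand side). -/
def sSeries (q : ℝ → ℂ) (S : ℂ → ℝ → ℂ) (x : ℝ) (ρ : ℂ) : ℂ :=
  Complex.sin (ρ * x) / ρ - Complex.cos (ρ * x) / ρ ^ 2 * omega q x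
    + Complex.sin (ρ * x) / ρ ^ 3 * qPlus q x
    - 1 / (2 * ρ ^ 3 * Complex.sin (ρ * x)) * ∑' n, sCoeff q S x n * sKernel x n ρ

/-- The same expression with the division by `2 sin(ρx)` carried out termwise, so that it is
meaningful for every `ρ ≠ 0`. -/
def sSeriesFilled (q : ℝ → ℂ) (S : ℂ → ℝ → ℂ) (x : ℝ) (ρ : ℂ) : ℂ :=
  Complex.sin (ρ * x) / ρ - Complex.cos (ρ * x) / ρ ^ 2 * omega q x
    + Complex.sin (ρ * x) / ρ ^ 3 * qPlus q x
    - 1 / ρ ^ 3 * ∑' n, sCoeff q S x n * sKernelQuot x n ρ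

/-- The cardinal series representation of `φ(ρ,x)` (right-hand side); the series runs over
`n = 1, 2, …`. -/
def phiSeries (q : ℝ → ℂ) (h : ℂ) (φ : ℂ → ℝ → ℂ) (x : ℝ) (ρ : ℂ) : ℂ :=
  Complex.cos (ρ * x) + Complex.sin (ρ * x) / ρ * (h + omega q x)
    - x / ρ * sphericalJ1 (ρ * x) * qH q h x
    - 1 / ρ ^ 2 * ∑' n : ℕ, phiCoeff q h φ x (n + 1) * phiKernel x (n + 1) ρ

end SincSL

end

/-! Multiplied by a power of `ρ` and freed of its leading asymptotic terms, each solution is, for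
fixed `x`, the Fourier transform of a function in `L²(-x,x)`: a Paley–Wiener function. Both series
are the sampling expansions of these remainders, and their coefficients are the samples.

The Paley–Wiener property is handled by duality. `PWBound` says that `f` defines a bounded
functional on exponential polynomials in `L²(-x,x)`; Hahn–Banach and Riesz turn it into `f ρ = ⟪v,
exp(iρ·)⟫` (`PWBound.exists_inner`). No transmutation kernel is constructed. The bound passes
through the Volterra equation of the problem: `sinQuot ρ (x - t)` averages translations by at most
`x - t`, so it takes type `t` to type `x`, and iteration gains the factorials that sum the Neumann
series (`PWBound.of_volterra_eq`). It remains to see that the explicit main part solves the Volterra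
equation up to Paley–Wiener terms; one integration by parts, using `q' ∈ L₂`, shows this and
produces `q⁺` and `qʰ` (`volterra_sine_asymptotics`, `volterra_cosine_asymptotics`).

Expanding `v` in the Fourier basis of `L²(-x,x)` gives the sampling series. The sine remainder is
odd and is sampled at half-integer nodes, after a real shift; the cosine remainder is even and,
corrected by a multiple of sinc, vanishes at `0`. Every mode of convergence follows from
unconditional convergence in the Hilbert space (`convergesLikeCardinalSeries_of_hasSum`). -/

noncomputable section

namespace SincSL

open scoped ComplexConjugate InnerProductSpace ENNReal

/-! ### Exponentials in `L²(-x,x)` -/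

/-- The exponential `t ↦ exp(iρt)` as a continuous function on the real line. -/
def expFun (ρ : ℂ) : C(ℝ, ℂ) :=
  ⟨fun t => Complex.exp (Complex.I * ρ * t), by fun_prop⟩

@[simp]
theorem expFun_apply (ρ : ℂ) (t : ℝ) : expFun ρ t = Complex.exp (Complex.I * ρ * t) := rfl

/-- The Hilbert space `L²(-x,x]`, realised on the circle of length `2x`. -/
abbrev CircleL2 (x : ℝ) [Fact (0 < 2 * x)] : Type :=
  Lp ℂ 2 (AddCircle.haarAddCircle (T := 2 * x))

theorem integral_exp_eq_csinc {x : ℝ} (hx0 : x ≠ 0) (ρ : ℂ) :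
    (2 * x : ℂ)⁻¹ * ∫ t in (-x)..x, Complex.exp (Complex.I * ρ * t) =
      csinc (ρ * x / Real.pi) := by
  have hxc : (x : ℂ) ≠ 0 := by exact_mod_cast hx0
  have hpi : (Real.pi : ℂ) ≠ 0 := by exact_mod_cast Real.pi_ne_zero
  unfold csinc
  by_cases hρ : ρ = 0
  · simp [hρ]
    field_simp
    norm_num
  · have h0 : ρ * x / Real.pi ≠ 0 := by positivity
    rw [if_neg h0, integral_exp_mul_complex (mul_ne_zero Complex.I_ne_zero hρ),
      show (Real.pi : ℂ) * (ρ * x / Real.pi) = ρ * x by field_simp, Complex.sin]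
    have e1 : Complex.I * ρ * (x : ℂ) = ρ * x * Complex.I := by ring
    have e2 : Complex.I * ρ * ((-x : ℝ) : ℂ) = -(ρ * x) * Complex.I := by push_cast; ring
    rw [e1, e2]
    field_simp
    rw [Complex.I_sq]
    ring

section Circle

variable {x : ℝ} [hx : Fact (0 < 2 * x)]

theorem memLp_liftIoc_continuousMap (f : C(ℝ, ℂ)) :
    MemLp (AddCircle.liftIoc (2 * x) (-x) f) 2 AddCircle.haarAddCircle := by
  refine (MemLp.memLp_liftIoc ?_).haarAddCircle
  obtain ⟨C, hC⟩ := (isCompact_Icc (a := -x) (b := -x + 2 * x)).exists_bound_of_continuousOn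
    f.continuous.continuousOn
  refine MemLp.of_bound f.continuous.aestronglyMeasurable C ?_
  filter_upwards [ae_restrict_mem measurableSet_Ioc] with t ht
  exact hC t (Set.Ioc_subset_Icc_self ht)

variable (x) in
/-- The restriction of a continuous function to `(-x,x]` as an element of `CircleL2 x`. -/
def restrictL2 : C(ℝ, ℂ) →ₗ[ℂ] CircleL2 x where
  toFun f := (memLp_liftIoc_continuousMap (x := x) f).toLp _
  map_add' _ _ := rfl
  map_smul' _ _ := rfl

theorem coeFn_restrictL2 (f : C(ℝ, ℂ)) :
    restrictL2 x f =ᵐ[AddCircle.haarAddCircle] AddCircle.liftIoc (2 * x) (-x) f :=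
  MemLp.coeFn_toLp (memLp_liftIoc_continuousMap f)

theorem inner_restrictL2 (f g : C(ℝ, ℂ)) :
    ⟪restrictL2 x f, restrictL2 x g⟫_ℂ = (2 * x : ℂ)⁻¹ * ∫ t in (-x)..x, conj (f t) * g t := by
  rw [MeasureTheory.L2.inner_def]
  have : (∫ a, ⟪restrictL2 x f a, restrictL2 x g a⟫_ℂ ∂AddCircle.haarAddCircle) =
      ∫ a, AddCircle.liftIoc (2 * x) (-x) (fun t => conj (f t) * g t) a
        ∂AddCircle.haarAddCircle := by
    refine integral_congr_ae ?_
    filter_upwards [coeFn_restrictL2 (x := x) f, coeFn_restrictL2 (x := x) g] with a ha hb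
    rw [ha, hb, RCLike.inner_apply']
    rfl
  rw [this, AddCircle.integral_haarAddCircle, AddCircle.integral_liftIoc_eq_intervalIntegral,
    show -x + 2 * x = x by ring, Complex.real_smul]
  push_cast
  rfl

theorem norm_restrictL2_sq (f : C(ℝ, ℂ)) :
    ‖restrictL2 x f‖ ^ 2 = (2 * x)⁻¹ * ∫ t in (-x)..x, ‖f t‖ ^ 2 := by
  have h := inner_restrictL2 (x := x) f f
  rw [inner_self_eq_norm_sq_to_K] at h
  have h2 : ∀ t : ℝ, conj (f t) * f t = ((‖f t‖ ^ 2 : ℝ) : ℂ) := fun t => by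
    rw [mul_comm, Complex.mul_conj, Complex.normSq_eq_norm_sq]
  simp only [h2, intervalIntegral.integral_ofReal] at h
  exact Complex.ofReal_injective (by push_cast; exact h)

variable (x) in
/-- The exponential `exp(iρ·)` in `CircleL2 x`. -/
def expL2 (ρ : ℂ) : CircleL2 x := restrictL2 x (expFun ρ)

/-- This is the reproducing kernel of the Paley–Wiener space; through it the cardinal sines enter.
The conjugate comes from the conjugate-linear first slot. -/
theorem inner_expL2 (ρ σ : ℂ) :
    ⟪expL2 x ρ, expL2 x σ⟫_ℂ = csinc ((σ - conj ρ) * x / Real.pi) := by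
  have hx0 : x ≠ 0 := by have := hx.out; intro h; simp [h] at this
  rw [← integral_exp_eq_csinc hx0, expL2, expL2, inner_restrictL2]
  congr 2
  ext t
  simp only [expFun_apply, ← Complex.exp_conj, map_mul, Complex.conj_I, Complex.conj_ofReal,
    ← Complex.exp_add]
  congr 1
  ring

theorem csinc_intCast (n : ℤ) : csinc n = if n = 0 then 1 else 0 := by
  unfold csinc
  split_ifs with h1 h2 h2
  · rfl
  · exact absurd (by exact_mod_cast h1) h2
  · exact absurd (by simp [h2]) h1
  · rw [mul_comm, Complex.sin_int_mul_pi, zero_div]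

/-- Frequencies differ by integer multiples of `π/x`, where sinc vanishes. An arbitrary real offset
`θ` is allowed because the `L₂(ℝ)` bound integrates Bessel's inequality over all offsets. -/
theorem orthonormal_expL2 (θ : ℝ) :
    Orthonormal ℂ fun m : ℤ => expL2 x (θ + m * (Real.pi / x : ℝ)) := by
  have hx0 : (x : ℂ) ≠ 0 := by
    have := hx.out
    norm_cast
    intro h; simp [h] at this
  have hpi : (Real.pi : ℂ) ≠ 0 := by exact_mod_cast Real.pi_ne_zero
  rw [orthonormal_iff_ite]
  intro i j
  rw [inner_expL2]
  simp only [map_add, map_mul, Complex.conj_ofReal, map_intCast]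
  rw [show ((θ : ℂ) + j * (Real.pi / x : ℝ) - (θ + i * (Real.pi / x : ℝ))) * x / Real.pi =
    ((j - i : ℤ) : ℂ) by push_cast; field_simp; ring, csinc_intCast]
  simp only [sub_eq_zero, eq_comm]

/-- Gives access to the completeness of the Fourier basis. -/
theorem expL2_eq_fourierLp (m : ℤ) : expL2 x (m * (Real.pi / x : ℝ)) = fourierLp 2 m := by
  have hx0 : (x : ℂ) ≠ 0 := by
    have := hx.out
    norm_cast
    intro h; simp [h] at this
  refine Lp.ext ((coeFn_restrictL2 (x := x) _).trans (EventuallyEq.trans ?_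
    (coeFn_fourierLp 2 m).symm))
  refine Eventually.of_forall fun a => ?_
  obtain ⟨t, ht, rfl⟩ : ∃ t ∈ Set.Ioc (-x) (-x + 2 * x), (t : AddCircle (2 * x)) = a :=
    ⟨AddCircle.equivIoc (2 * x) (-x) a, (AddCircle.equivIoc (2 * x) (-x) a).2,
      (AddCircle.equivIoc (2 * x) (-x)).symm_apply_apply a⟩
  rw [AddCircle.liftIoc_coe_apply ht, fourier_coe_apply, expFun_apply]
  congr 1
  push_cast
  field_simp

theorem norm_expL2_le (ρ : ℂ) : ‖expL2 x ρ‖ ≤ Real.exp (|ρ.im| * x) := by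
  have hx0 : 0 < x := by have := hx.out; linarith
  refine Lp.norm_le_of_ae_bound (μ := AddCircle.haarAddCircle (T := 2 * x)) (p := 2)
    (Real.exp_pos (|ρ.im| * x)).le ?_ |>.trans ?_
  · filter_upwards [coeFn_restrictL2 (x := x) (expFun ρ)] with a ha
    rw [expL2, ha]
    obtain ⟨t, ht, rfl⟩ : ∃ t ∈ Set.Ioc (-x) (-x + 2 * x), (t : AddCircle (2 * x)) = a :=
      ⟨AddCircle.equivIoc (2 * x) (-x) a, (AddCircle.equivIoc (2 * x) (-x) a).2,
        (AddCircle.equivIoc (2 * x) (-x)).symm_apply_apply a⟩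
    rw [AddCircle.liftIoc_coe_apply ht, expFun_apply, Complex.norm_exp]
    refine Real.exp_le_exp.2 ?_
    have h1 : (Complex.I * ρ * (t : ℂ)).re = -(ρ.im * t) := by simp
    have h2 : |t| ≤ x := abs_le.2 ⟨ht.1.le, by linarith [ht.2]⟩
    rw [h1]
    calc -(ρ.im * t) ≤ |ρ.im * t| := neg_le_abs _
      _ = |ρ.im| * |t| := abs_mul _ _
      _ ≤ |ρ.im| * x := by gcongr
  · simp [measureUnivNNReal]

variable (x) in
theorem continuous_inner_expL2 (v : CircleL2 x) : Continuous fun ρ : ℂ => ⟪v, expL2 x ρ⟫_ℂ := by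
  have hx0 : 0 < x := by have := hx.out; linarith
  suffices Continuous (expL2 x) from continuous_const.inner this
  refine continuous_iff_continuousAt.2 fun ρ₀ => ?_
  rw [ContinuousAt, tendsto_iff_norm_sub_tendsto_zero]
  have key : ∀ ρ, ‖expL2 x ρ - expL2 x ρ₀‖ ^ 2 =
      (2 * x)⁻¹ * ∫ t in (-x)..x, ‖expFun ρ t - expFun ρ₀ t‖ ^ 2 := fun ρ => by
    rw [expL2, expL2, ← map_sub, norm_restrictL2_sq]
    rfl
  have hc : Continuous fun ρ : ℂ => (2 * x)⁻¹ * ∫ t in (-x)..x, ‖expFun ρ t - expFun ρ₀ t‖ ^ 2 := by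
    refine continuous_const.mul
      (intervalIntegral.continuous_parametric_intervalIntegral_of_continuous' ?_ _ _)
    simp only [Function.uncurry_def, expFun_apply]
    fun_prop
  have h1 := (hc.tendsto ρ₀).sqrt
  simp only [← key, sub_self, norm_zero] at h1
  simpa using h1

end Circle

/-! ### Plancherel bound and modes of convergence -/

section Circle

variable {x : ℝ} [hx : Fact (0 < 2 * x)]

/-- Half of Plancherel, by periodization: the line is cut into translates of one period `π/x`. For
each offset `θ` the sum over translates is at most `‖w‖²` by Bessel's inequality, and the period
contributes the factor `π/x`. -/
theorem lintegral_inner_expL2_sq_le (w : CircleL2 x) :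
    ∫⁻ ρ : ℝ, ‖⟪w, expL2 x ρ⟫_ℂ‖ₑ ^ 2 ≤ ENNReal.ofReal (Real.pi / x) * ‖w‖ₑ ^ 2 := by
  have hx0 : 0 < x := by have := hx.out; linarith
  have hp : 0 < Real.pi / x := by positivity
  have hmeas : Measurable fun ρ : ℝ => ‖⟪w, expL2 x ρ⟫_ℂ‖ₑ ^ 2 :=
    ((continuous_inner_expL2 x w).comp Complex.continuous_ofReal).measurable.enorm.pow_const 2
  have hfund := (isAddFundamentalDomain_Ioc hp 0 volume).lintegral_eq_tsum''
    fun ρ : ℝ => ‖⟪w, expL2 x ρ⟫_ℂ‖ₑ ^ 2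
  rw [hfund, ← lintegral_tsum]
  · have hb : ∀ θ : ℝ, ∑' g : AddSubgroup.zmultiples (Real.pi / x),
        ‖⟪w, expL2 x ((g +ᵥ θ : ℝ) : ℂ)⟫_ℂ‖ₑ ^ 2 ≤ ‖w‖ₑ ^ 2 := fun θ => by
      choose n hn using fun g : AddSubgroup.zmultiples (Real.pi / x) =>
        AddSubgroup.mem_zmultiples_iff.1 g.2
      have hinj : Function.Injective n := fun g g' h => Subtype.ext (by rw [← hn g, ← hn g', h])
      have hg : ∀ g : AddSubgroup.zmultiples (Real.pi / x),
          ((g +ᵥ θ : ℝ) : ℂ) = θ + n g * (Real.pi / x : ℝ) := fun g => by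
        have : (g +ᵥ θ : ℝ) = g + θ := rfl
        rw [this, ← hn g]
        push_cast [zsmul_eq_mul]
        ring
      have ho := (orthonormal_expL2 (x := x) θ).comp n hinj
      rw [ENNReal.tsum_eq_iSup_sum]
      refine iSup_le fun s => ?_
      have h1 := ho.sum_inner_products_le w (s := s)
      have h2 : ∀ y : ℂ, ‖y‖ₑ ^ 2 = ENNReal.ofReal (‖y‖ ^ 2) := fun y => by
        rw [← ofReal_norm, ENNReal.ofReal_pow (norm_nonneg _)]
      have h3 : ‖w‖ₑ ^ 2 = ENNReal.ofReal (‖w‖ ^ 2) := by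
        rw [← ofReal_norm, ENNReal.ofReal_pow (norm_nonneg _)]
      simp only [h2, h3]
      rw [← ENNReal.ofReal_sum_of_nonneg fun _ _ => by positivity]
      refine ENNReal.ofReal_le_ofReal (le_trans (le_of_eq ?_) h1)
      refine Finset.sum_congr rfl fun g _ => ?_
      rw [hg, norm_inner_symm]
      rfl
    refine (lintegral_mono hb).trans ?_
    simp [mul_comm]
  · intro g
    exact (hmeas.comp (measurable_const_vadd g)).aemeasurable

theorem eLpNorm_inner_expL2_le (w : CircleL2 x) (δ : ℝ) :
    eLpNorm (fun ρ : ℝ => ⟪w, expL2 x (ρ + δ)⟫_ℂ) 2 volume ≤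
      ENNReal.ofReal (Real.pi / x) ^ (1 / 2 : ℝ) * ‖w‖ₑ := by
  have h0 := lintegral_add_right_eq_self (μ := (volume : Measure ℝ))
    (fun ρ : ℝ => ‖⟪w, expL2 x ρ⟫_ℂ‖ₑ ^ 2) δ
  have h := ENNReal.rpow_le_rpow (h0.le.trans (lintegral_inner_expL2_sq_le w))
    (by norm_num : (0 : ℝ) ≤ 1 / 2)
  rw [eLpNorm_eq_lintegral_rpow_enorm_toReal (by norm_num) (by norm_num)]
  rw [ENNReal.mul_rpow_of_nonneg _ _ (by norm_num), ← ENNReal.rpow_natCast, ← ENNReal.rpow_mul] at h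
  norm_num at h ⊢
  exact h

/-- Each remainder of the series is `m ρ` times the inner product of the Hilbert space remainder
with an exponential. Cauchy–Schwarz gives uniform convergence wherever `m` and the exponentials are
bounded, and the Plancherel bound gives the `L₂` norm. The multiplier `m` allows a factor such as `2
sin(ρx)`; `δ` undoes a shift of the sampling nodes. -/
theorem convergesLikeCardinalSeries_of_hasSum {m : ℂ → ℂ} (hm : Continuous m) {B : ℝ}
    (hB : ∀ ρ : ℝ, ‖m ρ‖ ≤ B) (δ : ℝ) {a : ℕ → CircleL2 x} {v : CircleL2 x} (h : HasSum a v)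
    {f : ℕ → ℂ → ℂ} (hf : ∀ n ρ, f n ρ = m ρ * ⟪a n, expL2 x (ρ + δ)⟫_ℂ) :
    (∀ ρ, HasSum (fun n => f n ρ) (m ρ * ⟪v, expL2 x (ρ + δ)⟫_ℂ)) ∧ ConvergesLikeCardinalSeries f := by
  have hx0 : 0 < x := by have := hx.out; linarith
  have hB0 : 0 ≤ B := (norm_nonneg _).trans (hB 0)
  have hsum : ∀ ρ, HasSum (fun n => f n ρ) (m ρ * ⟪v, expL2 x (ρ + δ)⟫_ℂ) := fun ρ => by
    simp only [hf]
    refine HasSum.mul_left _ ?_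
    exact h.map (innerSLFlip ℂ (expL2 x (ρ + δ))) (innerSLFlip ℂ (expL2 x (ρ + δ))).continuous
  have htsum : ∀ ρ, ∑' n, f n ρ = m ρ * ⟪v, expL2 x (ρ + δ)⟫_ℂ := fun ρ => (hsum ρ).tsum_eq
  have hdiff : ∀ N ρ, (∑ n ∈ Finset.range N, f n ρ) - ∑' n, f n ρ =
      m ρ * ⟪(∑ n ∈ Finset.range N, a n) - v, expL2 x (ρ + δ)⟫_ℂ := fun N ρ => by
    rw [htsum, inner_sub_left, sum_inner, mul_sub, Finset.mul_sum]
    simp only [hf]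
  have hlim : Tendsto (fun N => ‖(∑ n ∈ Finset.range N, a n) - v‖) atTop (𝓝 0) :=
    tendsto_iff_norm_sub_tendsto_zero.1 h.tendsto_sum_nat
  have hunif : ∀ (K : Set ℂ) (M : ℝ), (∀ ρ ∈ K, ‖m ρ‖ * ‖expL2 x (ρ + δ)‖ ≤ M) →
      TendstoUniformlyOn (fun (N : ℕ) (ρ : ℂ) => ∑ n ∈ Finset.range N, f n ρ)
        (fun ρ => ∑' n, f n ρ) atTop K := fun K M hM => by
    rw [Metric.tendstoUniformlyOn_iff]
    intro ε hε
    have h0 : Tendsto (fun N => M * ‖(∑ n ∈ Finset.range N, a n) - v‖) atTop (𝓝 0) := by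
      simpa using hlim.const_mul M
    filter_upwards [h0.eventually_lt_const hε] with N hN ρ hρ
    rw [dist_comm, dist_eq_norm, hdiff, norm_mul]
    calc ‖m ρ‖ * ‖⟪(∑ n ∈ Finset.range N, a n) - v, expL2 x (ρ + δ)⟫_ℂ‖
        ≤ ‖m ρ‖ * (‖(∑ n ∈ Finset.range N, a n) - v‖ * ‖expL2 x (ρ + δ)‖) := by
          gcongr; exact norm_inner_le_norm _ _
      _ = ‖m ρ‖ * ‖expL2 x (ρ + δ)‖ * ‖(∑ n ∈ Finset.range N, a n) - v‖ := by ring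
      _ ≤ M * ‖(∑ n ∈ Finset.range N, a n) - v‖ := by gcongr; exact hM ρ hρ
      _ < ε := hN
  have hmeas : ∀ w : CircleL2 x, AEStronglyMeasurable (fun ρ : ℝ => m ρ * ⟪w, expL2 x (ρ + δ)⟫_ℂ) volume :=
    fun w => ((hm.mul ((continuous_inner_expL2 x w).comp (continuous_add_const (δ : ℂ)))).comp
      Complex.continuous_ofReal).aestronglyMeasurable
  have hnorm : ∀ w : CircleL2 x, eLpNorm (fun ρ : ℝ => m ρ * ⟪w, expL2 x (ρ + δ)⟫_ℂ) 2 volume ≤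
      ENNReal.ofReal B * (ENNReal.ofReal (Real.pi / x) ^ (1 / 2 : ℝ) * ‖w‖ₑ) := fun w => by
    refine (eLpNorm_le_mul_eLpNorm_of_ae_le_mul (Eventually.of_forall fun ρ => ?_) 2).trans
      (mul_le_mul_right (eLpNorm_inner_expL2_le w δ) _)
    rw [norm_mul]
    gcongr
    exact hB ρ
  have hfin : ENNReal.ofReal (Real.pi / x) ^ (1 / 2 : ℝ) ≠ ∞ :=
    ENNReal.rpow_ne_top_of_nonneg (by norm_num) ENNReal.ofReal_ne_top
  have hmem : ∀ w : CircleL2 x, MemLp (fun ρ : ℝ => m ρ * ⟪w, expL2 x (ρ + δ)⟫_ℂ) 2 volume := fun w =>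
    ⟨hmeas w, (hnorm w).trans_lt
      (ENNReal.mul_lt_top ENNReal.ofReal_lt_top (ENNReal.mul_lt_top hfin.lt_top enorm_lt_top))⟩
  refine ⟨hsum, fun K hK => ?_, fun ρ => (hsum ρ).summable.norm, ?_, fun n => ?_, ?_, ?_⟩
  · obtain ⟨M₁, hM₁⟩ := hK.exists_bound_of_continuousOn hm.continuousOn
    obtain ⟨M₂, hM₂⟩ := hK.exists_bound_of_continuousOn (f := fun ρ : ℂ => ρ.im)
      Complex.continuous_im.continuousOn
    refine hunif K (M₁ * Real.exp (M₂ * x)) fun ρ hρ => ?_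
    have h1 := hM₁ ρ hρ
    have h2 := hM₂ ρ hρ
    rw [Real.norm_eq_abs] at h2
    refine mul_le_mul h1 ((norm_expL2_le (ρ + δ)).trans (Real.exp_le_exp.2 ?_)) (norm_nonneg _)
      ((norm_nonneg _).trans h1)
    rw [Complex.add_im, Complex.ofReal_im, add_zero]
    gcongr
  · have := hunif (Set.range ((↑) : ℝ → ℂ)) B (by
      rintro _ ⟨ρ, rfl⟩
      have h1 := norm_expL2_le (x := x) ((ρ : ℂ) + δ)
      simp only [Complex.add_im, Complex.ofReal_im, add_zero, abs_zero, zero_mul, Real.exp_zero] at h1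
      calc _ ≤ B * 1 := mul_le_mul (hB ρ) h1 (norm_nonneg _) hB0
        _ = B := mul_one B)
    rw [← tendstoUniformlyOn_univ]
    exact (this.comp ((↑) : ℝ → ℂ)).mono fun ρ _ => ⟨ρ, rfl⟩
  · simp only [hf]
    exact hmem _
  · simp only [htsum]
    exact hmem _
  · simp only [hdiff]
    refine tendsto_of_tendsto_of_tendsto_of_le_of_le tendsto_const_nhds ?_ (fun _ => zero_le)
      fun N => hnorm _
    have h1 : Tendsto (fun N => ‖(∑ n ∈ Finset.range N, a n) - v‖ₑ) atTop (𝓝 0) := by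
      have := ENNReal.tendsto_ofReal hlim
      rw [ENNReal.ofReal_zero] at this
      exact this.congr fun N => ofReal_norm _
    have h2 := ENNReal.Tendsto.const_mul (ENNReal.Tendsto.const_mul h1 (.inr hfin))
      (.inr (ENNReal.ofReal_ne_top (r := B)))
    simpa using h2

end Circle

/-! ### Paley–Wiener functions as bounded functionals, and sampling -/

/-- The exponential polynomial `t ↦ ∑ c_ρ exp(iρt)`. -/
def expPoly (s : Finset ℂ) (c : ℂ → ℂ) : C(ℝ, ℂ) := ∑ ρ ∈ s, c ρ • expFun ρ

theorem expPoly_apply (s : Finset ℂ) (c : ℂ → ℂ) (t : ℝ) :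
    expPoly s c t = ∑ ρ ∈ s, c ρ * Complex.exp (Complex.I * ρ * t) := by
  simp [expPoly, ContinuousMap.sum_apply]

/-- The norm of an exponential polynomial in `L²(-x,x)`. -/
def expNorm (x : ℝ) (s : Finset ℂ) (c : ℂ → ℂ) : ℝ :=
  Real.sqrt (∫ t in (-x)..x, ‖expPoly s c t‖ ^ 2)

/-- `f` is bounded, by the constant `C`, as a functional on the exponential polynomials in
`L²(-x,x)`; equivalently, `f` is the Fourier transform of a square integrable function on
`(-x,x)`. -/
def PWBound (C x : ℝ) (f : ℂ → ℂ) : Prop :=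
  ∀ (s : Finset ℂ) (c : ℂ → ℂ), ‖∑ ρ ∈ s, c ρ * f ρ‖ ≤ C * expNorm x s c

section Circle

variable {x : ℝ} [hx : Fact (0 < 2 * x)]

/-- The bound makes `exp(iρ·) ↦ f ρ` well defined and continuous on the span of the exponentials;
Hahn–Banach extends it and Riesz represents the extension. -/
theorem PWBound.exists_inner {C : ℝ} {f : ℂ → ℂ} (hf : PWBound C x f) :
    ∃ v : CircleL2 x, ∀ ρ, f ρ = ⟪v, expL2 x ρ⟫_ℂ := by
  let Λ : (ℂ →₀ ℂ) →ₗ[ℂ] ℂ := Finsupp.linearCombination ℂ f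
  let E : (ℂ →₀ ℂ) →ₗ[ℂ] CircleL2 x := Finsupp.linearCombination ℂ (expL2 x)
  have hbound : ∀ c, ‖Λ c‖ ≤ C * Real.sqrt (2 * x) * ‖E c‖ := fun c => by
    have h1 : E c = restrictL2 x (expPoly c.support c) := by
      simp only [E, Finsupp.linearCombination_apply, Finsupp.sum, expPoly, map_sum, map_smul, expL2]
    have h2 : Real.sqrt (2 * x) * ‖E c‖ = expNorm x c.support c := by
      rw [expNorm, ← Real.sqrt_sq (norm_nonneg (E c)), ← Real.sqrt_mul hx.out.le, h1,
        norm_restrictL2_sq, mul_inv_cancel_left₀ hx.out.ne']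
    rw [mul_assoc, h2]
    simpa [Λ, Finsupp.linearCombination_apply, Finsupp.sum] using hf c.support c
  -- A linear relation between exponentials in `L²` is also one between the values of `f`, so `Λ`
  -- descends to the range of `E`.
  have hker : LinearMap.ker E ≤ LinearMap.ker Λ := fun c hc => by
    have := hbound c
    rw [LinearMap.mem_ker.1 hc, norm_zero, mul_zero] at this
    exact LinearMap.mem_ker.2 (norm_le_zero_iff.1 this)
  let g : LinearMap.range E →ₗ[ℂ] ℂ :=
    ((LinearMap.ker E).liftQ Λ hker).comp E.quotKerEquivRange.symm.toLinearMap
  have hg : ∀ c, g ⟨E c, LinearMap.mem_range_self E c⟩ = Λ c := fun c => by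
    simp only [g, LinearMap.comp_apply, LinearEquiv.coe_coe]
    rw [show E.quotKerEquivRange.symm ⟨E c, LinearMap.mem_range_self E c⟩ =
      (LinearMap.ker E).mkQ c from E.quotKerEquivRange_symm_apply_image c _]
    simp
  obtain ⟨G, hG, -⟩ := exists_extension_norm_eq (LinearMap.range E)
    (g.mkContinuous (C * Real.sqrt (2 * x)) (by
      rintro ⟨_, c, rfl⟩
      rw [hg]
      exact hbound c))
  refine ⟨(InnerProductSpace.toDual ℂ _).symm G, fun ρ => ?_⟩
  have h3 : E (Finsupp.single ρ 1) = expL2 x ρ := by simp [E]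
  have h4 := hG ⟨E (Finsupp.single ρ 1), LinearMap.mem_range_self E _⟩
  rw [LinearMap.mkContinuous_apply, hg] at h4
  rw [InnerProductSpace.toDual_symm_apply, ← h3]
  simpa [Λ] using h4.symm

variable (x) in
/-- The projection of `v` to the span of `exp(iπmt/x)`. -/
def sampleTerm (v : CircleL2 x) (m : ℤ) : CircleL2 x :=
  ⟪expL2 x (m * (Real.pi / x : ℝ)), v⟫_ℂ • expL2 x (m * (Real.pi / x : ℝ))

theorem hasSum_sampleTerm (v : CircleL2 x) : HasSum (sampleTerm x v) v := by
  have := (fourierBasis (T := 2 * x)).hasSum_repr v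
  simp only [HilbertBasis.repr_apply_apply, coe_fourierBasis, ← expL2_eq_fourierLp] at this
  exact this

/-- The Fourier coefficient is a sample of the Paley–Wiener function, so `hasSum_sampleTerm` becomes
the sampling series. -/
theorem inner_sampleTerm (v : CircleL2 x) (m : ℤ) (ρ : ℂ) :
    ⟪sampleTerm x v m, expL2 x ρ⟫_ℂ =
      ⟪v, expL2 x (m * (Real.pi / x : ℝ))⟫_ℂ * csinc (ρ * x / Real.pi - m) := by
  have hx0 : (x : ℂ) ≠ 0 := by
    have := hx.out
    norm_cast
    intro h; simp [h] at this
  have hpi : (Real.pi : ℂ) ≠ 0 := by exact_mod_cast Real.pi_ne_zero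
  rw [sampleTerm, inner_smul_left, inner_conj_symm, inner_expL2]
  congr 2
  simp only [map_mul, Complex.conj_ofReal, map_intCast]
  push_cast
  field_simp

end Circle

/-! ### Operations preserving Paley–Wiener bounds -/

/-- The entire function `ρ ↦ sin(ρa)/ρ`, as a function of `a`. -/
def sinQuot (ρ : ℂ) (a : ℝ) : ℂ := 2⁻¹ * ∫ u in (-a)..a, Complex.exp (Complex.I * ρ * u)

theorem hasDerivAt_sinQuot (ρ : ℂ) (a : ℝ) :
    HasDerivAt (sinQuot ρ) (Complex.cos (ρ * a)) a := by
  have hc : Continuous fun u : ℝ => Complex.exp (Complex.I * ρ * u) := by fun_prop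
  have hi : ∀ b c, IntervalIntegrable (fun u : ℝ => Complex.exp (Complex.I * ρ * u)) volume b c :=
    fun b c => hc.intervalIntegrable b c
  have hd : ∀ b : ℝ, HasDerivAt (fun b => ∫ u in (0 : ℝ)..b, Complex.exp (Complex.I * ρ * u))
      (Complex.exp (Complex.I * ρ * b)) b := fun b => hc.integral_hasStrictDerivAt 0 b |>.hasDerivAt
  have h1 := (hd (-a)).scomp a (hasDerivAt_neg a)
  have h2 := ((hd a).sub h1).const_mul (2⁻¹ : ℂ)
  convert! h2 using 1
  · ext b
    simp only [sinQuot, Function.comp_apply, Pi.sub_apply]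
    rw [intervalIntegral.integral_interval_sub_left (hi _ _) (hi _ _)]
  · simp only [Complex.cos, Complex.ofReal_neg, neg_smul, one_smul, sub_neg_eq_add]
    rw [inv_mul_eq_div]
    congr 3 <;> ring

@[fun_prop]
theorem continuous_sinQuot (ρ : ℂ) : Continuous (sinQuot ρ) :=
  continuous_iff_continuousAt.2 fun a => (hasDerivAt_sinQuot ρ a).continuousAt

@[simp]
theorem sinQuot_zero_right (ρ : ℂ) : sinQuot ρ 0 = 0 := by simp [sinQuot]

theorem mul_sinQuot (ρ : ℂ) (a : ℝ) : ρ * sinQuot ρ a = Complex.sin (ρ * a) := by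
  by_cases hρ : ρ = 0
  · simp [hρ]
  · rw [sinQuot, integral_exp_mul_complex (mul_ne_zero Complex.I_ne_zero hρ), Complex.sin,
      show Complex.I * ρ * (a : ℂ) = ρ * a * Complex.I by ring,
      show Complex.I * ρ * ((-a : ℝ) : ℂ) = -(ρ * a) * Complex.I by push_cast; ring]
    field_simp
    rw [Complex.I_sq]
    ring

theorem sinQuot_neg_left (ρ : ℂ) (a : ℝ) : sinQuot (-ρ) a = sinQuot ρ a := by
  have := intervalIntegral.integral_comp_neg (a := -a) (b := a)
    (fun u : ℝ => Complex.exp (Complex.I * ρ * u))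
  rw [neg_neg] at this
  rw [sinQuot, sinQuot, ← this]
  congr 3
  ext u
  push_cast
  ring_nf

theorem expNorm_nonneg (x : ℝ) (s : Finset ℂ) (c : ℂ → ℂ) : 0 ≤ expNorm x s c := Real.sqrt_nonneg _

theorem expPoly_shift (s : Finset ℂ) (c : ℂ → ℂ) (u t : ℝ) :
    expPoly s (fun ρ => c ρ * Complex.exp (Complex.I * ρ * u)) t = expPoly s c (u + t) := by
  simp only [expPoly_apply]
  refine Finset.sum_congr rfl fun ρ _ => ?_
  rw [mul_assoc, ← Complex.exp_add]
  push_cast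
  ring_nf

/-- Translating `[-t,t]` by at most `a` stays inside `[-x,x]`; this is how exponential types add. -/
theorem expNorm_shift_le {t a x : ℝ} (ht : 0 ≤ t) (hx : t + a ≤ x) (s : Finset ℂ) (c : ℂ → ℂ)
    {u : ℝ} (hu : |u| ≤ a) :
    expNorm t s (fun ρ => c ρ * Complex.exp (Complex.I * ρ * u)) ≤ expNorm x s c := by
  obtain ⟨h1, h2⟩ := abs_le.1 hu
  refine Real.sqrt_le_sqrt ?_
  simp only [expPoly_shift]
  rw [intervalIntegral.integral_comp_add_left (fun t => ‖expPoly s c t‖ ^ 2)]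
  refine intervalIntegral.integral_mono_interval (by linarith) (by linarith) (by linarith)
    (Eventually.of_forall fun _ => by positivity) ?_
  exact Continuous.intervalIntegrable (by fun_prop) _ _

theorem PWBound.mono {C C' x : ℝ} {f : ℂ → ℂ} (h : PWBound C x f) (hC : C ≤ C') : PWBound C' x f :=
  fun s c => (h s c).trans (mul_le_mul_of_nonneg_right hC (expNorm_nonneg _ _ _))

theorem PWBound.add {C C' x : ℝ} {f g : ℂ → ℂ} (hf : PWBound C x f) (hg : PWBound C' x g) :
    PWBound (C + C') x fun ρ => f ρ + g ρ := fun s c => by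
  simp only [mul_add, Finset.sum_add_distrib, add_mul]
  exact (norm_add_le _ _).trans (add_le_add (hf s c) (hg s c))

theorem PWBound.const_mul {C x : ℝ} {f : ℂ → ℂ} (hf : PWBound C x f) (z : ℂ) :
    PWBound (‖z‖ * C) x fun ρ => z * f ρ := fun s c => by
  simp only [mul_left_comm (c _) z, ← Finset.mul_sum, norm_mul, mul_assoc]
  exact mul_le_mul_of_nonneg_left (hf s c) (norm_nonneg z)

/-- Real translations preserve the Paley--Wiener property. -/
theorem PWBound.comp_add {C x : ℝ} {f : ℂ → ℂ} (hf : PWBound C x f) (δ : ℝ) :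
    PWBound C x fun ρ => f (ρ + δ) := fun s c => by
  have hinj : Function.Injective fun ρ : ℂ => ρ + δ := add_left_injective _
  have h := hf (s.map ⟨_, hinj⟩) fun ρ => c (ρ - δ)
  simp only [Finset.sum_map, Function.Embedding.coeFn_mk, add_sub_cancel_right] at h
  refine h.trans (le_of_eq ?_)
  rw [expNorm, expNorm]
  congr 2
  refine intervalIntegral.integral_congr fun t _ => ?_
  -- A real frequency shift multiplies the exponential polynomial by a unimodular factor.
  have : expPoly (s.map ⟨_, hinj⟩) (fun ρ => c (ρ - δ)) t =
      Complex.exp ((δ * t : ℝ) * Complex.I) * expPoly s c t := by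
    simp only [expPoly_apply, Finset.sum_map, Function.Embedding.coeFn_mk, add_sub_cancel_right,
      Finset.mul_sum]
    refine Finset.sum_congr rfl fun ρ _ => ?_
    rw [mul_left_comm, ← Complex.exp_add]
    push_cast
    ring_nf
  simp only [this, norm_mul, Complex.norm_exp_ofReal_mul_I, one_mul]

theorem PWBound.integral {x : ℝ} (hx : 0 ≤ x) {C : ℝ → ℝ} {f : ℂ → ℝ → ℂ}
    (hf : ∀ t ∈ Set.Ioc 0 x, PWBound (C t) x fun ρ => f ρ t)
    (hC : IntervalIntegrable C volume 0 x)
    (hfi : ∀ ρ, IntervalIntegrable (f ρ) volume 0 x) :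
    PWBound (∫ t in (0 : ℝ)..x, C t) x fun ρ => ∫ t in (0 : ℝ)..x, f ρ t := fun s c => by
  simp only [← intervalIntegral.integral_const_mul]
  rw [← intervalIntegral.integral_finsetSum fun ρ _ => (hfi ρ).const_mul (c ρ),
    ← intervalIntegral.integral_mul_const]
  exact intervalIntegral.norm_integral_le_of_norm_le hx
    (Eventually.of_forall fun t ht => hf t ht s c) (hC.mul_const _)

/-- Averaging of the translations by at most `a`. -/
theorem PWBound.sinQuot_mul {C t a x : ℝ} (hC : 0 ≤ C) (ht : 0 ≤ t) (ha : 0 ≤ a) (hx : t + a ≤ x)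
    {f : ℂ → ℂ} (hf : PWBound C t f) : PWBound (a * C) x fun ρ => sinQuot ρ a * f ρ := fun s c => by
  have hi : ∀ ρ : ℂ, IntervalIntegrable
      (fun u : ℝ => c ρ * Complex.exp (Complex.I * ρ * u) * f ρ) volume (-a) a :=
    fun ρ => Continuous.intervalIntegrable (by fun_prop) _ _
  have h1 : ∑ ρ ∈ s, c ρ * (sinQuot ρ a * f ρ) =
      2⁻¹ * ∫ u in (-a)..a, ∑ ρ ∈ s, c ρ * Complex.exp (Complex.I * ρ * u) * f ρ := by
    rw [intervalIntegral.integral_finsetSum fun ρ _ => hi ρ, Finset.mul_sum]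
    refine Finset.sum_congr rfl fun ρ _ => ?_
    rw [intervalIntegral.integral_mul_const, intervalIntegral.integral_const_mul, sinQuot]
    ring
  have h2 := intervalIntegral.norm_integral_le_of_norm_le_const (a := -a) (b := a)
    (f := fun u : ℝ => ∑ ρ ∈ s, c ρ * Complex.exp (Complex.I * ρ * u) * f ρ)
    (C := C * expNorm x s c) fun u hu => by
      rw [Set.uIoc_of_le (by linarith)] at hu
      refine (hf s fun ρ => c ρ * Complex.exp (Complex.I * ρ * u)).trans ?_
      exact mul_le_mul_of_nonneg_left
        (expNorm_shift_le ht hx s c (abs_le.2 ⟨hu.1.le, hu.2⟩)) hC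
  rw [h1, norm_mul]
  rw [sub_neg_eq_add, abs_of_nonneg (by linarith)] at h2
  have h3 : ‖(2⁻¹ : ℂ)‖ = 2⁻¹ := by norm_num
  rw [h3]
  linarith

/-! ### The Volterra operator and its Neumann series -/

/-- The Volterra operator `f ↦ ∫₀ˣ ρ⁻¹ sin(ρ(x-t)) q(t) f(t) dt`. -/
def volterra (q : ℝ → ℂ) (ρ : ℂ) (f : ℝ → ℂ) (x : ℝ) : ℂ :=
  ∫ t in (0 : ℝ)..x, sinQuot ρ (x - t) * (q t * f t)

theorem volterra_congr {q q' : ℝ → ℂ} {ρ : ℂ} {f g : ℝ → ℂ} {L : ℝ}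
    (hq : ∀ t ∈ Set.Icc 0 L, q t = q' t) (h : ∀ t ∈ Set.Icc 0 L, f t = g t) :
    ∀ x ∈ Set.Icc 0 L, volterra q ρ f x = volterra q' ρ g x := fun x hx => by
  refine intervalIntegral.integral_congr fun t ht => ?_
  rw [Set.uIcc_of_le hx.1] at ht
  have ht' : t ∈ Set.Icc 0 L := ⟨ht.1, ht.2.trans hx.2⟩
  simp only [hq t ht', h t ht']

/-- Induction step of both factorial estimates for the Volterra iterates. -/
theorem integral_pow_div_factorial (C M x : ℝ) (n : ℕ) :
    ∫ t in (0 : ℝ)..x, M * (C * ((M * t) ^ n / n.factorial)) =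
      C * ((M * x) ^ (n + 1) / (n + 1).factorial) := by
  have : ∀ t : ℝ, M * (C * ((M * t) ^ n / n.factorial)) =
      (C * M ^ (n + 1) / n.factorial) * t ^ n := fun t => by rw [mul_pow, pow_succ]; ring
  have h2 : (∫ t in (0 : ℝ)..x, M * (C * ((M * t) ^ n / n.factorial))) =
      (C * M ^ (n + 1) / n.factorial) * (x ^ (n + 1) / (n + 1)) := by
    rw [funext this, intervalIntegral.integral_const_mul, integral_pow]
    simp
  rw [h2, Nat.factorial_succ, mul_pow]
  have : (n.factorial : ℝ) ≠ 0 := by positivity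
  push_cast
  field_simp

section Continuous

variable {q : ℝ → ℂ} (hq : Continuous q) {ρ : ℂ}
include hq

theorem continuous_volterra_integrand {f : ℝ → ℂ} (hf : Continuous f) (x : ℝ) :
    Continuous fun t => sinQuot ρ (x - t) * (q t * f t) :=
  ((continuous_sinQuot ρ).comp (continuous_const.sub continuous_id)).mul (hq.mul hf)

theorem continuous_volterra {f : ℝ → ℂ} (hf : Continuous f) : Continuous (volterra q ρ f) := by
  have hs := continuous_sinQuot ρ
  refine intervalIntegral.continuous_parametric_intervalIntegral_of_continuous
    (f := fun x t => sinQuot ρ (x - t) * (q t * f t)) ?_ continuous_id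
  simp only [Function.uncurry_def]
  fun_prop

theorem continuous_volterra_iterate {f : ℝ → ℂ} (hf : Continuous f) (n : ℕ) :
    Continuous ((volterra q ρ)^[n] f) := by
  induction n with
  | zero => exact hf
  | succ n ih =>
    rw [Function.iterate_succ_apply']
    exact continuous_volterra hq ih

theorem volterra_add {f g : ℝ → ℂ} (hf : Continuous f) (hg : Continuous g) (x : ℝ) :
    volterra q ρ (fun t => f t + g t) x = volterra q ρ f x + volterra q ρ g x := by
  rw [volterra, volterra, volterra, ← intervalIntegral.integral_add
    ((continuous_volterra_integrand hq hf x).intervalIntegrable _ _)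
    ((continuous_volterra_integrand hq hg x).intervalIntegrable _ _)]
  simp only [mul_add]

theorem volterra_iterate_eq {f f₀ : ℝ → ℂ} {L : ℝ} (hf : Continuous f) (hf₀ : Continuous f₀)
    (h : ∀ x ∈ Set.Icc 0 L, f x = f₀ x + volterra q ρ f x) (n : ℕ) :
    ∀ x ∈ Set.Icc 0 L,
      (volterra q ρ)^[n] f x = (volterra q ρ)^[n] f₀ x + (volterra q ρ)^[n + 1] f x := by
  induction n with
  | zero => exact h
  | succ n ih =>
    intro x hx
    rw [Function.iterate_succ_apply', volterra_congr (fun _ _ => rfl) ih x hx,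
      volterra_add hq (continuous_volterra_iterate hq hf₀ n)
        (continuous_volterra_iterate hq hf (n + 1)),
      ← Function.iterate_succ_apply' (volterra q ρ) n f₀,
      ← Function.iterate_succ_apply' (volterra q ρ) (n + 1) f]

theorem neumann_partial_sum {f f₀ : ℝ → ℂ} {L : ℝ} (hf : Continuous f) (hf₀ : Continuous f₀)
    (h : ∀ x ∈ Set.Icc 0 L, f x = f₀ x + volterra q ρ f x) {x : ℝ} (hx : x ∈ Set.Icc 0 L) (n : ℕ) :
    ∑ k ∈ Finset.range n, (volterra q ρ)^[k] f₀ x = f x - (volterra q ρ)^[n] f x := by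
  induction n with
  | zero => simp
  | succ n ih =>
    rw [Finset.sum_range_succ, ih, volterra_iterate_eq hq hf hf₀ h n x hx]
    ring

theorem tendsto_volterra_iterate {f : ℝ → ℂ} (hf : Continuous f) {x : ℝ} (hx : 0 ≤ x) :
    Tendsto (fun n => (volterra q ρ)^[n] f x) atTop (𝓝 0) := by
  obtain ⟨B, hB⟩ := (isCompact_Icc (a := (0 : ℝ)) (b := x)).exists_bound_of_continuousOn
    hf.continuousOn
  obtain ⟨Q, hQ⟩ := (isCompact_Icc (a := (0 : ℝ)) (b := x)).exists_bound_of_continuousOn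
    hq.continuousOn
  obtain ⟨M, hM⟩ := (isCompact_Icc (a := (0 : ℝ)) (b := x)).exists_bound_of_continuousOn
    (continuous_sinQuot ρ).continuousOn
  have hQ0 : 0 ≤ Q := (norm_nonneg _).trans (hQ 0 ⟨le_rfl, hx⟩)
  have hM0 : 0 ≤ M := (norm_nonneg _).trans (hM 0 ⟨le_rfl, hx⟩)
  have key : ∀ n, ∀ y ∈ Set.Icc 0 x,
      ‖(volterra q ρ)^[n] f y‖ ≤ B * ((M * Q * y) ^ n / n.factorial) := by
    intro n
    induction n with
    | zero => intro y hy; simpa using hB y hy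
    | succ n ih =>
      intro y hy
      rw [Function.iterate_succ_apply', ← integral_pow_div_factorial]
      refine intervalIntegral.norm_integral_le_of_norm_le hy.1 (Eventually.of_forall fun t ht => ?_)
        (Continuous.intervalIntegrable (by fun_prop) _ _)
      have ht' : t ∈ Set.Icc 0 x := ⟨ht.1.le, ht.2.trans hy.2⟩
      rw [norm_mul, norm_mul, ← mul_assoc]
      exact mul_le_mul (mul_le_mul (hM _ ⟨by linarith [ht.2], by linarith [ht.1, hy.2]⟩) (hQ t ht')
        (norm_nonneg _) hM0) (ih t ht') (norm_nonneg _) (by positivity)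
  have h0 := (FloorSemiring.tendsto_pow_div_factorial_atTop (M * Q * x)).const_mul B
  rw [mul_zero] at h0
  exact squeeze_zero_norm (fun n => key n x ⟨hx, le_rfl⟩) h0

/-- At each `t` the kernel averages translations by at most `x - t`, raising the type from `t` to `t
+ (x - t) = x`. The factor `L * Q` bounds `x - t` times `‖q t‖`. -/
theorem PWBound.volterra {L Q : ℝ} (hQ : ∀ t ∈ Set.Icc 0 L, ‖q t‖ ≤ Q) {C : ℝ → ℝ}
    (hC : Continuous C) (hC0 : ∀ t ∈ Set.Icc 0 L, 0 ≤ C t) {F : ℂ → ℝ → ℂ}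
    (hF : ∀ ρ, Continuous (F ρ))
    (h : ∀ t ∈ Set.Icc 0 L, PWBound (C t) t fun ρ => F ρ t) {x : ℝ} (hx : x ∈ Set.Icc 0 L) :
    PWBound (∫ t in (0 : ℝ)..x, L * Q * C t) x fun ρ => volterra q ρ (F ρ) x := by
  refine PWBound.integral hx.1 (fun t ht => ?_)
    (Continuous.intervalIntegrable (by fun_prop) _ _)
    (fun ρ => (continuous_volterra_integrand hq (hF ρ) x).intervalIntegrable _ _)
  have ht' : t ∈ Set.Icc 0 L := ⟨ht.1.le, ht.2.trans hx.2⟩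
  have h1 := ((h t ht').const_mul (q t)).sinQuot_mul (x := x) (a := x - t)
    (mul_nonneg (norm_nonneg _) (hC0 t ht')) ht.1.le (by linarith [ht.2]) (by linarith)
  refine h1.mono ?_
  rw [mul_assoc]
  have := hC0 t ht'
  exact mul_le_mul (by linarith [ht.1, hx.2]) (mul_le_mul_of_nonneg_right (hQ t ht') this)
    (by positivity) (hx.1.trans hx.2)

/-- The solution of a Volterra equation inherits the Paley--Wiener property from its free term. -/
theorem PWBound.of_volterra_eq {L Q : ℝ} (hQ : ∀ t ∈ Set.Icc 0 L, ‖q t‖ ≤ Q) {C : ℝ} (hC : 0 ≤ C)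
    {F F₀ : ℂ → ℝ → ℂ} (hF : ∀ ρ, Continuous (F ρ)) (hF₀ : ∀ ρ, Continuous (F₀ ρ))
    (h : ∀ ρ, ∀ x ∈ Set.Icc 0 L, F ρ x = F₀ ρ x + SincSL.volterra q ρ (F ρ) x)
    (hb : ∀ t ∈ Set.Icc 0 L, PWBound C t fun ρ => F₀ ρ t) {x : ℝ} (hx : x ∈ Set.Icc 0 L) :
    PWBound (C * Real.exp (L * Q * x)) x fun ρ => F ρ x := by
  have hL : 0 ≤ L := hx.1.trans hx.2
  have hQ0 : 0 ≤ Q := (norm_nonneg _).trans (hQ 0 ⟨le_rfl, hL⟩)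
  have key : ∀ n : ℕ, ∀ t ∈ Set.Icc 0 L, PWBound (C * ((L * Q * t) ^ n / n.factorial)) t
      fun ρ => (SincSL.volterra q ρ)^[n] (F₀ ρ) t := by
    intro n
    induction n with
    | zero => intro t ht; simpa using hb t ht
    | succ n ih =>
      intro t ht
      simp only [Function.iterate_succ_apply', ← integral_pow_div_factorial]
      refine PWBound.volterra hq hQ (by fun_prop) (fun t ht => ?_)
        (fun ρ => continuous_volterra_iterate hq (hF₀ ρ) n) ih ht
      have := ht.1
      positivity
  intro s c
  -- For a fixed exponential polynomial only pointwise convergence of the Neumann series at finitely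
  -- many `ρ` is needed; the bounds on partial sums do not depend on `ρ`.
  have hlim : Tendsto (fun n => ∑ ρ ∈ s, c ρ *
      ∑ k ∈ Finset.range n, (SincSL.volterra q ρ)^[k] (F₀ ρ) x) atTop (𝓝 (∑ ρ ∈ s, c ρ * F ρ x)) := by
    refine tendsto_finsetSum _ fun ρ _ => Tendsto.const_mul _ ?_
    simp only [neumann_partial_sum hq (hF ρ) (hF₀ ρ) (h ρ) hx]
    simpa using (tendsto_const_nhds (x := F ρ x)).sub (tendsto_volterra_iterate hq (hF ρ) hx.1)
  refine le_of_tendsto' hlim.norm fun n => ?_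
  have : ∑ ρ ∈ s, c ρ * ∑ k ∈ Finset.range n, (SincSL.volterra q ρ)^[k] (F₀ ρ) x =
      ∑ k ∈ Finset.range n, ∑ ρ ∈ s, c ρ * (SincSL.volterra q ρ)^[k] (F₀ ρ) x := by
    simp only [Finset.mul_sum]
    exact Finset.sum_comm
  rw [this]
  calc _ ≤ ∑ k ∈ Finset.range n, C * ((L * Q * x) ^ k / k.factorial) * expNorm x s c :=
        norm_sum_le_of_le _ fun k _ => key k x hx s c
    _ = C * (∑ k ∈ Finset.range n, (L * Q * x) ^ k / k.factorial) * expNorm x s c := by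
        rw [← Finset.sum_mul, ← Finset.mul_sum]
    _ ≤ _ := by
        refine mul_le_mul_of_nonneg_right (mul_le_mul_of_nonneg_left
          (Real.sum_le_exp_of_nonneg ?_ n) hC) (expNorm_nonneg _ _ _)
        have := hx.1
        positivity

end Continuous

/-- Real reflection preserves the Paley--Wiener property. -/
theorem PWBound.comp_neg {C x : ℝ} {f : ℂ → ℂ} (hf : PWBound C x f) :
    PWBound C x fun ρ => f (-ρ) := fun s c => by
  have h := hf (s.map ⟨_, neg_injective⟩) fun ρ => c (-ρ)
  simp only [Finset.sum_map, Function.Embedding.coeFn_mk, neg_neg] at h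
  refine h.trans (le_of_eq ?_)
  rw [expNorm, expNorm]
  congr 2
  have : ∀ t : ℝ, expPoly (s.map ⟨_, neg_injective⟩) (fun ρ => c (-ρ)) t = expPoly s c (-t) := by
    intro t
    simp only [expPoly_apply, Finset.sum_map, Function.Embedding.coeFn_mk, neg_neg]
    refine Finset.sum_congr rfl fun ρ _ => ?_
    push_cast
    ring_nf
  simp only [this]
  rw [intervalIntegral.integral_comp_neg (fun t => ‖expPoly s c t‖ ^ 2), neg_neg]

/-! ### Paley–Wiener bounds for explicit transforms -/

/-- Cauchy--Schwarz inequality for interval integrals. -/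
theorem integral_norm_mul_norm_le_sqrt {a b : ℝ} (hab : a ≤ b) {f g : ℝ → ℂ}
    (hf : MemLp f 2 (volume.restrict (Set.Ioc a b)))
    (hg : MemLp g 2 (volume.restrict (Set.Ioc a b))) :
    ∫ t in a..b, ‖f t‖ * ‖g t‖ ≤
      Real.sqrt (∫ t in a..b, ‖f t‖ ^ 2) * Real.sqrt (∫ t in a..b, ‖g t‖ ^ 2) := by
  have h := integral_mul_norm_le_Lp_mul_Lq (μ := volume.restrict (Set.Ioc a b)) (f := f) (g := g)
    Real.HolderConjugate.two_two (by simpa using hf) (by simpa using hg)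
  simpa only [intervalIntegral.integral_of_le hab, Real.sqrt_eq_rpow, Real.rpow_two] using h

theorem memLp_two_of_continuous {f : ℝ → ℂ} (hf : Continuous f) (a b : ℝ) :
    MemLp f 2 (volume.restrict (Set.Ioc a b)) := by
  obtain ⟨C, hC⟩ := (isCompact_Icc (a := a) (b := b)).exists_bound_of_continuousOn hf.continuousOn
  refine MemLp.of_bound hf.aestronglyMeasurable C ?_
  filter_upwards [ae_restrict_mem measurableSet_Ioc] with t ht
  exact hC t (Set.Ioc_subset_Icc_self ht)

/-- The substitution `u = x - 2t` carries `[0,x]` onto `[-x,x]`, so Cauchy–Schwarz bounds the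
functional by the norm of `g`. -/
theorem pwBound_integral_exp {x : ℝ} (hx : 0 ≤ x) {g : ℝ → ℂ}
    (hg : MemLp g 2 (volume.restrict (Set.Ioc 0 x))) :
    PWBound (Real.sqrt (∫ t in (0 : ℝ)..x, ‖g t‖ ^ 2)) x
      fun ρ => ∫ t in (0 : ℝ)..x, g t * Complex.exp (Complex.I * ρ * (x - 2 * t : ℝ)) := fun s c => by
  have hgi : IntervalIntegrable g volume 0 x :=
    (intervalIntegrable_iff_integrableOn_Ioc_of_le hx).2 (hg.integrable (by norm_num))
  have h1 : ∑ ρ ∈ s, c ρ * ∫ t in (0 : ℝ)..x, g t * Complex.exp (Complex.I * ρ * (x - 2 * t : ℝ)) =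
      ∫ t in (0 : ℝ)..x, g t * expPoly s c (x - 2 * t) := by
    simp only [← intervalIntegral.integral_const_mul]
    rw [← intervalIntegral.integral_finsetSum fun ρ _ =>
      (hgi.mul_continuousOn (Continuous.continuousOn (by fun_prop))).const_mul (c ρ)]
    simp only [expPoly_apply, Finset.mul_sum, mul_left_comm]
  have hP : Continuous fun t : ℝ => expPoly s c (x - 2 * t) := by fun_prop
  have h2 : ∫ t in (0 : ℝ)..x, ‖expPoly s c (x - 2 * t)‖ ^ 2 ≤
      ∫ t in (-x)..x, ‖expPoly s c t‖ ^ 2 := by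
    rw [intervalIntegral.integral_comp_sub_mul (fun t => ‖expPoly s c t‖ ^ 2) two_ne_zero,
      show x - 2 * x = -x by ring, mul_zero, sub_zero, smul_eq_mul]
    have : 0 ≤ ∫ t in (-x)..x, ‖expPoly s c t‖ ^ 2 :=
      intervalIntegral.integral_nonneg (by linarith) fun _ _ => by positivity
    linarith
  rw [h1]
  calc _ ≤ ∫ t in (0 : ℝ)..x, ‖g t * expPoly s c (x - 2 * t)‖ :=
        intervalIntegral.norm_integral_le_integral_norm hx
    _ = ∫ t in (0 : ℝ)..x, ‖g t‖ * ‖expPoly s c (x - 2 * t)‖ := by simp only [norm_mul]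
    _ ≤ _ := integral_norm_mul_norm_le_sqrt hx hg (memLp_two_of_continuous hP 0 x)
    _ ≤ _ := mul_le_mul_of_nonneg_left (Real.sqrt_le_sqrt h2) (Real.sqrt_nonneg _)

/-- A single exponential corresponds to a point evaluation, which is not bounded in `L²`. The
average over `[-a,a]` is, by Cauchy–Schwarz against the constant `1`. -/
theorem pwBound_sinQuot_mul_exp {x a t : ℝ} (ha : 0 ≤ a) (ht : 0 ≤ t) (hx : t + a ≤ x) :
    PWBound (Real.sqrt (2 * x)) x
      fun ρ => sinQuot ρ a * Complex.exp (Complex.I * ρ * t) := fun s c => by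
  have hx0 : 0 ≤ x := by linarith
  have h1 : ∑ ρ ∈ s, c ρ * (sinQuot ρ a * Complex.exp (Complex.I * ρ * t)) =
      2⁻¹ * ∫ u in (-a)..a, expPoly s c (u + t) := by
    have hi : ∀ ρ : ℂ, IntervalIntegrable
        (fun u : ℝ => c ρ * Complex.exp (Complex.I * ρ * (u + t : ℝ))) volume (-a) a :=
      fun ρ => Continuous.intervalIntegrable (by fun_prop) _ _
    simp only [expPoly_apply]
    rw [intervalIntegral.integral_finsetSum fun ρ _ => hi ρ, Finset.mul_sum]
    refine Finset.sum_congr rfl fun ρ _ => ?_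
    have : ∀ u : ℝ, c ρ * Complex.exp (Complex.I * ρ * (u + t : ℝ)) =
        c ρ * Complex.exp (Complex.I * ρ * t) * Complex.exp (Complex.I * ρ * u) := fun u => by
      rw [mul_assoc (c ρ), ← Complex.exp_add]
      push_cast
      ring_nf
    simp only [this]
    rw [intervalIntegral.integral_const_mul, sinQuot]
    ring
  have h2 : ‖∫ u in (-a)..a, expPoly s c (u + t)‖ ≤ Real.sqrt (2 * x) * expNorm x s c := by
    calc _ ≤ ∫ u in (-a)..a, ‖expPoly s c (u + t)‖ :=
          intervalIntegral.norm_integral_le_integral_norm (by linarith)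
      _ ≤ ∫ u in (-x)..x, ‖expPoly s c u‖ := by
          rw [intervalIntegral.integral_comp_add_right (fun u => ‖expPoly s c u‖)]
          refine intervalIntegral.integral_mono_interval (by linarith) (by linarith) (by linarith)
            (Eventually.of_forall fun _ => norm_nonneg _) ?_
          exact Continuous.intervalIntegrable (by fun_prop) _ _
      _ = ∫ u in (-x)..x, ‖(1 : ℂ)‖ * ‖expPoly s c u‖ := by simp
      _ ≤ _ := integral_norm_mul_norm_le_sqrt (by linarith)
          (memLp_two_of_continuous continuous_const _ _)
          (memLp_two_of_continuous (expPoly s c).continuous _ _)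
      _ = _ := by
          rw [expNorm]
          simp only [norm_one, one_pow, intervalIntegral.integral_const, smul_eq_mul, mul_one]
          congr 2
          ring
  have h3 : ‖(2⁻¹ : ℂ)‖ = 2⁻¹ := by norm_num
  rw [h1, norm_mul, h3]
  have := norm_nonneg (∫ u in (-a)..a, expPoly s c (u + t))
  linarith

/-! ### Bounds uniform in the space variable -/

/-- A family of functions that have the Paley--Wiener property uniformly on `[0,L]`. -/
def PWFamily (L : ℝ) (F : ℂ → ℝ → ℂ) : Prop :=
  ∃ C, 0 ≤ C ∧ ∀ x ∈ Set.Icc 0 L, PWBound C x fun ρ => F ρ x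

namespace PWFamily

variable {L : ℝ} {F G : ℂ → ℝ → ℂ}

theorem add (hF : PWFamily L F) (hG : PWFamily L G) : PWFamily L fun ρ x => F ρ x + G ρ x := by
  obtain ⟨C, hC, h⟩ := hF
  obtain ⟨C', hC', h'⟩ := hG
  exact ⟨C + C', add_nonneg hC hC', fun x hx => (h x hx).add (h' x hx)⟩

theorem const_mul (hF : PWFamily L F) (z : ℂ) : PWFamily L fun ρ x => z * F ρ x := by
  obtain ⟨C, hC, h⟩ := hF
  exact ⟨‖z‖ * C, by positivity, fun x hx => (h x hx).const_mul z⟩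

theorem comp_neg (hF : PWFamily L F) : PWFamily L fun ρ x => F (-ρ) x := by
  obtain ⟨C, hC, h⟩ := hF
  exact ⟨C, hC, fun x hx => (h x hx).comp_neg⟩

theorem congr (hF : PWFamily L F) (h : ∀ ρ, ∀ x ∈ Set.Icc 0 L, G ρ x = F ρ x) : PWFamily L G := by
  obtain ⟨C, hC, hb⟩ := hF
  refine ⟨C, hC, fun x hx => ?_⟩
  simp only [h _ x hx]
  exact hb x hx

theorem integral_exp {g : ℝ → ℂ} (hg : MemLp g 2 (volume.restrict (Set.Ioc 0 L))) :
    PWFamily L fun ρ x =>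
      ∫ t in (0 : ℝ)..x, g t * Complex.exp (Complex.I * ρ * (x - 2 * t : ℝ)) := by
  refine ⟨Real.sqrt (∫ t in (0 : ℝ)..L, ‖g t‖ ^ 2), Real.sqrt_nonneg _, fun x hx => ?_⟩
  refine (pwBound_integral_exp hx.1
    (hg.mono_measure (Measure.restrict_mono (Set.Ioc_subset_Ioc_right hx.2) le_rfl))).mono ?_
  refine Real.sqrt_le_sqrt (intervalIntegral.integral_mono_interval le_rfl hx.1 hx.2
    (Eventually.of_forall fun _ => by positivity) ?_)
  exact (intervalIntegrable_iff_integrableOn_Ioc_of_le (hx.1.trans hx.2)).2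
    (hg.integrable_norm_pow (by norm_num))

theorem integral_cos {g : ℝ → ℂ} (hg : MemLp g 2 (volume.restrict (Set.Ioc 0 L))) :
    PWFamily L fun ρ x => ∫ t in (0 : ℝ)..x, g t * Complex.cos (ρ * (x - 2 * t)) := by
  have h := integral_exp hg
  refine ((h.add h.comp_neg).const_mul 2⁻¹).congr fun ρ x hx => ?_
  have hgi : IntervalIntegrable g volume 0 x :=
    (intervalIntegrable_iff_integrableOn_Ioc_of_le hx.1).2 ((hg.mono_measure
      (Measure.restrict_mono (Set.Ioc_subset_Ioc_right hx.2) le_rfl)).integrable (by norm_num))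
  rw [← intervalIntegral.integral_add
    (hgi.mul_continuousOn (Continuous.continuousOn (by fun_prop)))
    (hgi.mul_continuousOn (Continuous.continuousOn (by fun_prop))),
    ← intervalIntegral.integral_const_mul]
  refine intervalIntegral.integral_congr fun t _ => ?_
  simp only [Complex.cos]
  push_cast
  ring_nf

theorem integral_sin {g : ℝ → ℂ} (hg : MemLp g 2 (volume.restrict (Set.Ioc 0 L))) :
    PWFamily L fun ρ x => ∫ t in (0 : ℝ)..x, g t * Complex.sin (ρ * (x - 2 * t)) := by
  have h := integral_exp hg
  refine ((h.comp_neg.add (h.const_mul (-1))).const_mul (2⁻¹ * Complex.I)).congr fun ρ x hx => ?_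
  have hgi : IntervalIntegrable g volume 0 x :=
    (intervalIntegrable_iff_integrableOn_Ioc_of_le hx.1).2 ((hg.mono_measure
      (Measure.restrict_mono (Set.Ioc_subset_Ioc_right hx.2) le_rfl)).integrable (by norm_num))
  rw [← intervalIntegral.integral_const_mul (-1 : ℂ), ← intervalIntegral.integral_add
    (hgi.mul_continuousOn (Continuous.continuousOn (by fun_prop)))
    ((hgi.mul_continuousOn (Continuous.continuousOn (by fun_prop))).const_mul (-1)),
    ← intervalIntegral.integral_const_mul]
  refine intervalIntegral.integral_congr fun t _ => ?_
  simp only [Complex.sin]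
  push_cast
  ring_nf

/-- The exponential is not itself a Paley–Wiener family, so boundedness must come from the smoothing
by `sinQuot` under the integral. -/
theorem volterra_exp {f : ℝ → ℂ} (hf : Continuous f) :
    PWFamily L fun ρ x => volterra f ρ (fun t => Complex.exp (Complex.I * ρ * t)) x := by
  obtain ⟨Q, hQ⟩ := (isCompact_Icc (a := (0 : ℝ)) (b := L)).exists_bound_of_continuousOn
    hf.continuousOn
  rcases lt_or_ge L 0 with hL | hL
  · exact ⟨0, le_rfl, fun x hx => absurd (hx.1.trans hx.2) (not_le.2 hL)⟩
  have hQ0 : 0 ≤ Q := (norm_nonneg _).trans (hQ 0 ⟨le_rfl, hL⟩)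
  refine ⟨L * (Q * Real.sqrt (2 * L)), by positivity, fun x hx => ?_⟩
  have h := PWBound.integral (x := x) hx.1 (C := fun _ => Q * Real.sqrt (2 * L))
    (f := fun ρ t => sinQuot ρ (x - t) * (f t * Complex.exp (Complex.I * ρ * t)))
    (fun t ht => by
      have h1 := (pwBound_sinQuot_mul_exp (x := x) (a := x - t) (t := t) (by linarith [ht.2])
        ht.1.le (by linarith)).const_mul (f t)
      simp only [mul_left_comm (f t)] at h1
      refine h1.mono (mul_le_mul (hQ t ⟨ht.1.le, ht.2.trans hx.2⟩) (Real.sqrt_le_sqrt ?_)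
        (Real.sqrt_nonneg _) hQ0)
      linarith [hx.2])
    (by simp) (fun ρ => (continuous_volterra_integrand hf (by fun_prop) x).intervalIntegrable _ _)
  refine h.mono ?_
  rw [intervalIntegral.integral_const, sub_zero, smul_eq_mul]
  exact mul_le_mul_of_nonneg_right hx.2 (by positivity)

theorem volterra_neg_left (f : ℝ → ℂ) (ρ : ℂ) : SincSL.volterra f (-ρ) = SincSL.volterra f ρ := by
  ext g x
  simp only [SincSL.volterra, sinQuot_neg_left]

theorem volterra_const_mul (f : ℝ → ℂ) (ρ z : ℂ) (g : ℝ → ℂ) (x : ℝ) :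
    SincSL.volterra f ρ (fun t => z * g t) x = z * SincSL.volterra f ρ g x := by
  simp only [SincSL.volterra, ← intervalIntegral.integral_const_mul]
  refine intervalIntegral.integral_congr fun t _ => ?_
  ring

theorem volterra_cos {f : ℝ → ℂ} (hf : Continuous f) :
    PWFamily L fun ρ x => volterra f ρ (fun t => Complex.cos (ρ * t)) x := by
  have h := volterra_exp (L := L) hf
  refine ((h.add h.comp_neg).const_mul 2⁻¹).congr fun ρ x hx => ?_
  rw [volterra_neg_left, ← volterra_add hf (by fun_prop) (by fun_prop), ← volterra_const_mul]
  congr 1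
  ext t
  rw [Complex.cos]
  ring_nf

theorem volterra_sin {f : ℝ → ℂ} (hf : Continuous f) :
    PWFamily L fun ρ x => volterra f ρ (fun t => Complex.sin (ρ * t)) x := by
  have h := volterra_exp (L := L) hf
  refine ((h.comp_neg.add (h.const_mul (-1))).const_mul (2⁻¹ * Complex.I)).congr fun ρ x hx => ?_
  rw [volterra_neg_left, ← volterra_const_mul _ _ (-1),
    ← volterra_add hf (by fun_prop) (by fun_prop), ← volterra_const_mul]
  congr 1
  ext t
  rw [Complex.sin]
  ring_nf

theorem sinQuot : PWFamily L SincSL.sinQuot := by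
  refine ⟨Real.sqrt (2 * L), Real.sqrt_nonneg _, fun x hx => ?_⟩
  have h := pwBound_sinQuot_mul_exp (x := x) (a := x) (t := 0) hx.1 le_rfl (by simp)
  simp only [Complex.ofReal_zero, mul_zero, Complex.exp_zero, mul_one] at h
  exact h.mono (Real.sqrt_le_sqrt (by linarith [hx.2]))

theorem volterra {q : ℝ → ℂ} (hq : Continuous q) (hF : PWFamily L F) (hc : ∀ ρ, Continuous (F ρ)) :
    PWFamily L fun ρ x => SincSL.volterra q ρ (F ρ) x := by
  obtain ⟨C, hC, h⟩ := hF
  obtain ⟨Q, hQ⟩ := (isCompact_Icc (a := (0 : ℝ)) (b := L)).exists_bound_of_continuousOn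
    hq.continuousOn
  rcases lt_or_ge L 0 with hL | hL
  · exact ⟨0, le_rfl, fun x hx => absurd (hx.1.trans hx.2) (not_le.2 hL)⟩
  have hQ0 : 0 ≤ Q := (norm_nonneg _).trans (hQ 0 ⟨le_rfl, hL⟩)
  refine ⟨L * (L * Q * C), by positivity, fun x hx => ?_⟩
  refine (PWBound.volterra hq hQ (C := fun _ => C) continuous_const (fun _ _ => hC) hc h hx).mono ?_
  rw [intervalIntegral.integral_const, sub_zero, smul_eq_mul]
  exact mul_le_mul_of_nonneg_right hx.2 (by positivity)

theorem of_volterra_eq {q : ℝ → ℂ} (hq : Continuous q) (hc : ∀ ρ, Continuous (F ρ))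
    (hc' : ∀ ρ, Continuous (G ρ))
    (h : ∀ ρ, ∀ x ∈ Set.Icc 0 L, F ρ x = G ρ x + SincSL.volterra q ρ (F ρ) x)
    (hG : PWFamily L G) : PWFamily L F := by
  obtain ⟨C, hC, hb⟩ := hG
  obtain ⟨Q, hQ⟩ := (isCompact_Icc (a := (0 : ℝ)) (b := L)).exists_bound_of_continuousOn
    hq.continuousOn
  rcases lt_or_ge L 0 with hL | hL
  · exact ⟨0, le_rfl, fun x hx => absurd (hx.1.trans hx.2) (not_le.2 hL)⟩
  have hQ0 : 0 ≤ Q := (norm_nonneg _).trans (hQ 0 ⟨le_rfl, hL⟩)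
  refine ⟨C * Real.exp (L * Q * L), by positivity, fun x hx => ?_⟩
  refine (PWBound.of_volterra_eq hq hQ hC hc hc' h hb hx).mono ?_
  refine mul_le_mul_of_nonneg_left (Real.exp_le_exp.2 ?_) hC
  exact mul_le_mul_of_nonneg_left hx.2 (by positivity)

end PWFamily

/-! ### From the differential equation to the Volterra equation -/

/-- Extending the derivative by zero gives a potential on the whole line, which frees later
arguments from endpoint conditions. -/
theorem MemW21.exists_extension {L : ℝ} {q : ℝ → ℂ} (hq : MemW21 L q) :
    ∃ p g : ℝ → ℂ, MemLp g 2 volume ∧ Integrable g volume ∧ Continuous p ∧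
      (∀ x, p x = p 0 + ∫ t in (0 : ℝ)..x, g t) ∧ ∀ x ∈ Set.Icc 0 L, q x = p x := by
  obtain ⟨g, hg, hqg⟩ := hq
  have hi : Integrable ((Set.Icc 0 L).indicator g) volume :=
    (integrable_indicator_iff measurableSet_Icc).2 (hg.integrable (by norm_num))
  refine ⟨fun x => q 0 + ∫ t in (0 : ℝ)..x, (Set.Icc 0 L).indicator g t,
    (Set.Icc 0 L).indicator g, (memLp_indicator_iff_restrict measurableSet_Icc).2 hg, hi, ?_,
    fun x => by simp, fun x hx => ?_⟩
  · exact continuous_const.add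
      (intervalIntegral.continuous_primitive (fun a b => hi.intervalIntegrable) 0)
  · rw [hqg x hx]
    congr 1
    refine intervalIntegral.integral_congr fun t ht => ?_
    rw [Set.uIcc_of_le hx.1] at ht
    have ht' : t ∈ Set.Icc 0 L := ⟨ht.1, ht.2.trans hx.2⟩
    exact (Set.indicator_of_mem ht' g).symm

theorem integral_indicator_Ici {s x : ℝ} (h0 : 0 ≤ s) (hx : s ≤ x) (f : ℝ → ℂ) :
    ∫ t in (0 : ℝ)..x, (Set.Ici s).indicator f t = ∫ t in s..x, f t := by
  rw [intervalIntegral.integral_of_le (h0.trans hx), intervalIntegral.integral_of_le hx,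
    integral_congr_ae (ae_restrict_of_ae
      (indicator_ae_eq_of_ae_eq_set (f := f) (Ioi_ae_eq_Ici (a := s)).symm)),
    integral_indicator measurableSet_Ioi, Measure.restrict_restrict measurableSet_Ioi,
    Set.inter_comm, Set.Ioc_inter_Ioi, max_eq_right h0]

/-- Integration by parts for a primitive of an integrable function. -/
theorem integral_mul_deriv_of_primitive {p g k k' : ℝ → ℂ} (hg : Integrable g volume)
    (hp : ∀ x, p x = p 0 + ∫ t in (0 : ℝ)..x, g t) (hk : ∀ t, HasDerivAt k (k' t) t)
    (hk' : Continuous k') {x : ℝ} (hx : 0 ≤ x) :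
    ∫ t in (0 : ℝ)..x, p t * k' t = p x * k x - p 0 * k 0 - ∫ t in (0 : ℝ)..x, g t * k t := by
  have hkc : Continuous k := continuous_iff_continuousAt.2 fun t => (hk t).continuousAt
  have hgi : ∀ a b, IntervalIntegrable g volume a b := fun a b => hg.intervalIntegrable
  have hftc : ∀ s, ∫ t in s..x, k' t = k x - k s := fun s =>
    intervalIntegral.integral_eq_sub_of_hasDerivAt (fun t _ => hk t) (hk'.intervalIntegrable _ _)
  have hpc : Continuous fun t => ∫ s in (0 : ℝ)..t, g s := intervalIntegral.continuous_primitive hgi 0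
  -- Fubini on the triangle `s ≤ t`, encoded by the indicator; no pointwise derivative of `p` is
  -- used.
  have hswap : ∫ t in (0 : ℝ)..x, (∫ s in (0 : ℝ)..t, g s) * k' t =
      ∫ s in (0 : ℝ)..x, g s * (k x - k s) := by
    have hint : Integrable (Function.uncurry fun t s => (Set.Iic t).indicator g s * k' t)
        ((volume.restrict (Set.uIoc 0 x)).prod (volume.restrict (Set.uIoc 0 x))) := by
      have h1 : Integrable (fun z : ℝ × ℝ => k' z.1 * g z.2)
          ((volume.restrict (Set.uIoc 0 x)).prod (volume.restrict (Set.uIoc 0 x))) :=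
        Integrable.mul_prod (f := k') (g := g)
          (hk'.integrableOn_uIoc) (hg.mono_measure Measure.restrict_le_self)
      have h2 := h1.indicator (s := {z : ℝ × ℝ | z.2 ≤ z.1})
        (measurableSet_le measurable_snd measurable_fst)
      refine h2.congr (Eventually.of_forall fun z => ?_)
      by_cases hz : z.2 ≤ z.1
      · simp [Function.uncurry, Set.indicator, hz, mul_comm]
      · simp [Function.uncurry, Set.indicator, hz]
    calc _ = ∫ t in (0 : ℝ)..x, ∫ s in (0 : ℝ)..x, (Set.Iic t).indicator g s * k' t := by
          refine intervalIntegral.integral_congr fun t ht => ?_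
          rw [Set.uIcc_of_le hx] at ht
          simp only [intervalIntegral.integral_mul_const]
          congr 1
          exact (intervalIntegral.integral_indicator ht).symm
      _ = ∫ s in (0 : ℝ)..x, ∫ t in (0 : ℝ)..x, (Set.Iic t).indicator g s * k' t :=
          intervalIntegral_intervalIntegral_swap (by
            rwa [IntegrableOn, Measure.volume_eq_prod, ← Measure.prod_restrict])
      _ = _ := by
          refine intervalIntegral.integral_congr fun s hs => ?_
          rw [Set.uIcc_of_le hx] at hs
          rw [← hftc, ← integral_indicator_Ici hs.1 hs.2, ← intervalIntegral.integral_const_mul]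
          refine intervalIntegral.integral_congr fun t _ => ?_
          by_cases hst : s ≤ t
          · simp [Set.indicator, hst]
          · simp [Set.indicator, hst]
  have h0 : ∫ t in (0 : ℝ)..x, p t * k' t =
      p 0 * (k x - k 0) + ∫ t in (0 : ℝ)..x, (∫ s in (0 : ℝ)..t, g s) * k' t := by
    rw [← hftc 0, ← intervalIntegral.integral_const_mul, ← intervalIntegral.integral_add]
    · refine intervalIntegral.integral_congr fun t _ => ?_
      rw [hp t]
      ring
    · exact (continuous_const.mul hk').intervalIntegrable _ _
    · exact (hpc.mul hk').intervalIntegrable _ _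
  rw [h0, hswap, hp x]
  simp only [mul_sub]
  rw [intervalIntegral.integral_sub ((hgi _ _).mul_const _)
    ((hgi _ _).mul_continuousOn hkc.continuousOn), intervalIntegral.integral_mul_const]
  ring

theorem IsSolution.volterra_eq {L : ℝ} {q p : ℝ → ℂ} (hp : Continuous p)
    (hqp : ∀ x ∈ Set.Icc 0 L, q x = p x) {ρ a b : ℂ} {y : ℝ → ℂ} (hy : IsSolution L q ρ a b y) :
    ∀ x ∈ Set.Icc 0 L,
      y x = a * Complex.cos (ρ * x) + b * sinQuot ρ x + volterra p ρ y x := by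
  obtain ⟨dy, hdy, hy1, ⟨ddy, hy2⟩, hy0, hdy0⟩ := hy
  intro x hx
  have hyc : ContinuousOn y (Set.Icc 0 L) := fun t ht => (hy1 t ht).continuousWithinAt
  have hsub : Set.Icc 0 x ⊆ Set.Icc 0 L := Set.Icc_subset_Icc_right hx.2
  have hsd : ∀ t : ℝ, HasDerivAt (fun t : ℝ => sinQuot ρ (x - t))
      (-Complex.cos (ρ * (x - t : ℝ))) t := fun t =>
    (hasDerivAt_sinQuot ρ (x - t)).comp_const_sub x t
  have hcd : ∀ t : ℝ, HasDerivAt (fun t : ℝ => Complex.cos (ρ * (x - t : ℝ)))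
      (ρ * (ρ * sinQuot ρ (x - t))) t := fun t => by
    have h1 : HasDerivAt (fun t : ℝ => ρ * ((x - t : ℝ) : ℂ)) (-ρ) t := by
      simpa using (((hasDerivAt_id t).const_sub x).ofReal_comp).const_mul ρ
    convert! (Complex.hasDerivAt_cos _).comp t h1 using 1
    rw [mul_sinQuot]
    ring
  have hsc : Continuous fun t : ℝ => sinQuot ρ (x - t) :=
    continuous_iff_continuousAt.2 fun t => (hsd t).continuousAt
  have hcc : Continuous fun t : ℝ => Complex.cos (ρ * (x - t : ℝ)) := by fun_prop
  -- Variation of constants: by the equation, the derivative of this combination of `dy` and `y` is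
  -- the Volterra integrand. It equals `y x` at `t = x` and the free term at `t = 0`.
  have key := intervalIntegral.integral_eq_sub_of_hasDerivAt_of_le hx.1
    (f := fun t => dy t * sinQuot ρ (x - t) + y t * Complex.cos (ρ * (x - t : ℝ)))
    (f' := fun t => sinQuot ρ (x - t) * (p t * y t))
    (((hdy.mono hsub).mul hsc.continuousOn).add ((hyc.mono hsub).mul hcc.continuousOn))
    (fun t ht => by
      have ht' : t ∈ Set.Ioo 0 L := ⟨ht.1, ht.2.trans_le hx.2⟩
      have ht'' := Set.Ioo_subset_Icc_self ht'
      obtain ⟨h1, h2⟩ := hy2 t ht'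
      have h3 := (hy1 t ht'').hasDerivAt (Icc_mem_nhds ht'.1 ht'.2)
      convert! (h1.mul (hsd t)).add (h3.mul (hcd t)) using 1
      rw [hqp t ht''] at h2
      linear_combination (sinQuot ρ (x - t)) * h2)
    (ContinuousOn.intervalIntegrable (by
      rw [Set.uIcc_of_le hx.1]
      exact hsc.continuousOn.mul (hp.continuousOn.mul (hyc.mono hsub))))
  rw [volterra, key, hy0, hdy0]
  simp
  ring

/-- Solutions, extended continuously to the real line. -/
theorem exists_continuous_solution {L : ℝ} (hL : 0 ≤ L) {q p : ℝ → ℂ} (hp : Continuous p)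
    (hqp : ∀ x ∈ Set.Icc 0 L, q x = p x) {a b : ℂ} {S : ℂ → ℝ → ℂ}
    (hS : ∀ ρ, IsSolution L q ρ a b (S ρ)) :
    ∃ Y : ℂ → ℝ → ℂ, (∀ ρ, Continuous (Y ρ)) ∧ (∀ ρ, ∀ x ∈ Set.Icc 0 L, S ρ x = Y ρ x) ∧
      ∀ ρ, ∀ x ∈ Set.Icc 0 L,
        Y ρ x = a * Complex.cos (ρ * x) + b * sinQuot ρ x + volterra p ρ (Y ρ) x := by
  have he : ∀ ρ, ∀ x ∈ Set.Icc 0 L,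
      S ρ x = Set.IccExtend hL ((Set.Icc 0 L).domRestrict (S ρ)) x := fun ρ x hx => by
    rw [Set.IccExtend_of_mem _ _ hx]
    rfl
  refine ⟨fun ρ => Set.IccExtend hL ((Set.Icc 0 L).domRestrict (S ρ)), fun ρ => ?_, he,
    fun ρ x hx => ?_⟩
  · obtain ⟨dy, -, hy1, -⟩ := hS ρ
    refine Continuous.Icc_extend' ?_
    exact continuousOn_iff_continuous_domRestrict.1 fun t ht => (hy1 t ht).continuousWithinAt
  · dsimp only
    rw [← he ρ x hx, (hS ρ).volterra_eq hp hqp x hx, volterra_congr (fun _ _ => rfl) (he ρ) x hx]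

/-- The solution depends on `ρ²` only. -/
theorem solution_neg {L : ℝ} {p : ℝ → ℂ} (hp : Continuous p) {a b : ℂ} {Y : ℂ → ℝ → ℂ}
    (hY : ∀ ρ, Continuous (Y ρ)) (h : ∀ ρ, ∀ x ∈ Set.Icc 0 L,
      Y ρ x = a * Complex.cos (ρ * x) + b * sinQuot ρ x + volterra p ρ (Y ρ) x)
    (ρ : ℂ) {x : ℝ} (hx : x ∈ Set.Icc 0 L) : Y (-ρ) x = Y ρ x := by
  obtain ⟨Q, hQ⟩ := (isCompact_Icc (a := (0 : ℝ)) (b := L)).exists_bound_of_continuousOn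
    hp.continuousOn
  -- The difference solves the homogeneous equation, so its bound has constant `0`; testing on a
  -- single exponential makes it vanish.
  have hb := PWBound.of_volterra_eq (F := fun ρ t => Y (-ρ) t + -1 * Y ρ t) (F₀ := fun _ _ => 0)
    hp hQ le_rfl (fun ρ => (hY _).add (continuous_const.mul (hY ρ))) (fun _ => continuous_const)
    (fun ρ t ht => by
      rw [volterra_add hp (hY _) (g := fun t => -1 * Y ρ t) (continuous_const.mul (hY ρ)), PWFamily.volterra_const_mul,
        h ρ t ht, h (-ρ) t ht, sinQuot_neg_left, PWFamily.volterra_neg_left, neg_mul,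
        Complex.cos_neg]
      ring)
    (fun t _ s c => by simp) hx {ρ} 1
  simp only [zero_mul, Finset.sum_singleton, norm_le_zero_iff, Pi.one_apply, one_mul] at hb
  linear_combination hb

/-- Zeroth order asymptotics of the solutions. -/
theorem pwFamily_solution_sub_free {L : ℝ} {p : ℝ → ℂ} (hp : Continuous p) {a b : ℂ} {Y : ℂ → ℝ → ℂ}
    (hY : ∀ ρ, Continuous (Y ρ)) (h : ∀ ρ, ∀ x ∈ Set.Icc 0 L,
      Y ρ x = a * Complex.cos (ρ * x) + b * sinQuot ρ x + volterra p ρ (Y ρ) x) :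
    PWFamily L fun ρ x => Y ρ x - (a * Complex.cos (ρ * x) + b * sinQuot ρ x) := by
  have hf : ∀ ρ, Continuous fun x : ℝ => a * Complex.cos (ρ * x) := fun ρ => by fun_prop
  have hf' : ∀ ρ, Continuous fun x : ℝ => b * sinQuot ρ x := fun ρ =>
    continuous_const.mul (continuous_sinQuot ρ)
  have hY' : ∀ ρ, Continuous fun x : ℝ => Y ρ x - (a * Complex.cos (ρ * x) + b * sinQuot ρ x) :=
    fun ρ => (hY ρ).sub ((hf ρ).add (hf' ρ))
  refine PWFamily.of_volterra_eq (G := fun ρ x => volterra p ρ (fun t => a * Complex.cos (ρ * t)) x +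
      volterra p ρ (fun t => b * sinQuot ρ t) x) hp hY'
    (fun ρ => (continuous_volterra hp (hf ρ)).add (continuous_volterra hp (hf' ρ)))
    (fun ρ x hx => ?_) ?_
  · rw [← volterra_add hp (hf ρ) (hf' ρ), ← volterra_add hp
      (f := fun x : ℝ => a * Complex.cos (ρ * x) + b * sinQuot ρ x) ((hf ρ).add (hf' ρ)) (hY' ρ)]
    simp only [add_sub_cancel]
    rw [h ρ x hx]
    ring
  · simp only [PWFamily.volterra_const_mul]
    exact ((PWFamily.volterra_cos hp).const_mul a).add
      ((PWFamily.sinQuot.volterra hp continuous_sinQuot).const_mul b)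

/-! ### Asymptotics with Paley–Wiener remainder -/

section Potential

variable {p g : ℝ → ℂ}

theorem hasDerivAt_omega (hp : Continuous p) (x : ℝ) : HasDerivAt (omega p) (1 / 2 * p x) x :=
  ((hp.integral_hasStrictDerivAt 0 x).hasDerivAt).const_mul _

@[fun_prop]
theorem continuous_omega (hp : Continuous p) : Continuous (omega p) :=
  continuous_iff_continuousAt.2 fun x => (hasDerivAt_omega hp x).continuousAt

@[fun_prop]
theorem continuous_qPlus (hp : Continuous p) : Continuous (qPlus p) := by
  unfold qPlus
  fun_prop

@[fun_prop]
theorem continuous_qH (hp : Continuous p) (h : ℂ) : Continuous (qH p h) := by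
  unfold qH
  fun_prop

theorem integral_eq_two_mul_omega (x : ℝ) : ∫ t in (0 : ℝ)..x, p t = 2 * omega p x := by
  rw [omega]
  ring

theorem integral_mul_omega (hp : Continuous p) (x : ℝ) :
    ∫ t in (0 : ℝ)..x, p t * omega p t = omega p x ^ 2 := by
  have h := intervalIntegral.integral_eq_sub_of_hasDerivAt (a := 0) (b := x)
    (f := fun t => omega p t ^ 2) (f' := fun t => p t * omega p t)
    (fun t _ => by
      convert! (hasDerivAt_omega hp t).pow 2 using 1
      ring)
    ((hp.mul (continuous_omega hp)).intervalIntegrable _ _)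
  rw [h]
  simp [omega]

theorem hasDerivAt_sin_mul_sub (ρ : ℂ) (x t : ℝ) :
    HasDerivAt (fun t : ℝ => -(1 / 2) * Complex.sin (ρ * (x - 2 * t)))
      (ρ * Complex.cos (ρ * (x - 2 * t))) t := by
  have h1 : HasDerivAt (fun t : ℝ => ρ * ((x : ℂ) - 2 * t)) (-(2 * ρ)) t := by
    convert! ((((hasDerivAt_id t).ofReal_comp).const_mul (2 : ℂ)).const_sub (x : ℂ)).const_mul ρ
      using 1
    simp
    ring
  convert! ((Complex.hasDerivAt_sin _).comp t h1).const_mul (-(1 / 2) : ℂ) using 1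
  ring

theorem hasDerivAt_cos_mul_sub (ρ : ℂ) (x t : ℝ) :
    HasDerivAt (fun t : ℝ => (1 / 2) * Complex.cos (ρ * (x - 2 * t)))
      (ρ * Complex.sin (ρ * (x - 2 * t))) t := by
  have h1 : HasDerivAt (fun t : ℝ => ρ * ((x : ℂ) - 2 * t)) (-(2 * ρ)) t := by
    convert! ((((hasDerivAt_id t).ofReal_comp).const_mul (2 : ℂ)).const_sub (x : ℂ)).const_mul ρ
      using 1
    simp
    ring
  convert! ((Complex.hasDerivAt_cos _).comp t h1).const_mul (1 / 2 : ℂ) using 1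
  ring

theorem sinQuot_mul_split (ρ : ℂ) (x t : ℝ) :
    ρ * (sinQuot ρ (x - t) * Complex.sin (ρ * t)) =
        1 / 2 * (Complex.cos (ρ * (x - 2 * t)) - Complex.cos (ρ * x)) ∧
      ρ * (sinQuot ρ (x - t) * Complex.cos (ρ * t)) =
        1 / 2 * (Complex.sin (ρ * x) + Complex.sin (ρ * (x - 2 * t))) := by
  have e1 : ρ * x = ρ * (x - t : ℝ) + ρ * t := by push_cast; ring
  have e2 : ρ * (x - 2 * t) = ρ * (x - t : ℝ) - ρ * t := by push_cast; ring
  rw [← mul_assoc, ← mul_assoc, mul_sinQuot, e1, e2]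
  simp only [Complex.cos_add, Complex.cos_sub, Complex.sin_add, Complex.sin_sub]
  constructor <;> ring

variable (hp : Continuous p) (hgi : Integrable g volume)
  (hpg : ∀ x, p x = p 0 + ∫ t in (0 : ℝ)..x, g t)
include hp hgi hpg

/-- The main part is reproduced, apart from `ρ² sin(ρx)`, up to Paley–Wiener terms. The leading term
gives `-ρω cos(ρx)` and an oscillating integral, whose integration by parts yields `(p x + p 0)/4`.
The `ω` term contributes `-ω²/2` because `∫ pω = ω²`. Together these make `qPlus`. -/
theorem volterra_sine_asymptotics (ρ : ℂ) {x : ℝ} (hx : 0 ≤ x) :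
    volterra p ρ (fun t => ρ ^ 2 * Complex.sin (ρ * t) - ρ * omega p t * Complex.cos (ρ * t) +
        qPlus p t * Complex.sin (ρ * t)) x =
      -ρ * omega p x * Complex.cos (ρ * x) + qPlus p x * Complex.sin (ρ * x) +
      ((1 / 4) * (∫ t in (0 : ℝ)..x, g t * Complex.sin (ρ * (x - 2 * t))) +
        (-(1 / 2)) * (∫ t in (0 : ℝ)..x, (p t * omega p t) * Complex.sin (ρ * (x - 2 * t))) +
        volterra (fun t => p t * qPlus p t) ρ (fun t => Complex.sin (ρ * t)) x) := by
  have hparts := integral_mul_deriv_of_primitive hgi hpg (hasDerivAt_sin_mul_sub ρ x)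
    (by fun_prop) hx
  have hsplit : ∀ t : ℝ, sinQuot ρ (x - t) * (p t * (ρ ^ 2 * Complex.sin (ρ * t) -
      ρ * omega p t * Complex.cos (ρ * t) + qPlus p t * Complex.sin (ρ * t))) =
      (1 / 2) * (p t * (ρ * Complex.cos (ρ * (x - 2 * t)))) +
      (-(1 / 2) * ρ * Complex.cos (ρ * x)) * p t +
      (-(1 / 2) * Complex.sin (ρ * x)) * (p t * omega p t) +
      (-(1 / 2)) * ((p t * omega p t) * Complex.sin (ρ * (x - 2 * t))) +
      sinQuot ρ (x - t) * (p t * qPlus p t * Complex.sin (ρ * t)) := fun t => by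
    obtain ⟨h1, h2⟩ := sinQuot_mul_split ρ x t
    linear_combination (ρ * p t) * h1 - p t * omega p t * h2
  have hi : ∀ {f : ℝ → ℂ}, Continuous f → IntervalIntegrable f volume 0 x :=
    fun hf => hf.intervalIntegrable _ _
  rw [volterra, volterra]
  simp only [hsplit]
  rw [intervalIntegral.integral_add (hi (by fun_prop)) (hi (by fun_prop)),
    intervalIntegral.integral_add (hi (by fun_prop)) (hi (by fun_prop)),
    intervalIntegral.integral_add (hi (by fun_prop)) (hi (by fun_prop)),
    intervalIntegral.integral_add (hi (by fun_prop)) (hi (by fun_prop))]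
  simp only [intervalIntegral.integral_const_mul]
  rw [hparts, integral_mul_omega hp, integral_eq_two_mul_omega (p := p)]
  have e1 : ρ * ((x : ℂ) - 2 * x) = -(ρ * x) := by ring
  have e2 : ∀ t : ℝ, g t * (-(1 / 2) * Complex.sin (ρ * (x - 2 * t))) =
      -(1 / 2) * (g t * Complex.sin (ρ * (x - 2 * t))) := fun t => by ring
  simp only [e1, e2, Complex.sin_neg, Complex.ofReal_zero, mul_zero, sub_zero,
    intervalIntegral.integral_const_mul, qPlus]
  ring

/-- The same mechanism; the boundary terms now enter with opposite signs, whence `p x - p 0`, and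
the `h` term adds `-hω`. -/
theorem volterra_cosine_asymptotics (h ρ : ℂ) {x : ℝ} (hx : 0 ≤ x) :
    volterra p ρ (fun t => ρ ^ 2 * Complex.cos (ρ * t) +
        ρ * (h + omega p t) * Complex.sin (ρ * t) + qH p h t * Complex.cos (ρ * t)) x =
      ρ * omega p x * Complex.sin (ρ * x) + qH p h x * Complex.cos (ρ * x) +
      ((-(1 / 4)) * (∫ t in (0 : ℝ)..x, g t * Complex.cos (ρ * (x - 2 * t))) +
        (1 / 2) * (∫ t in (0 : ℝ)..x, (p t * (h + omega p t)) * Complex.cos (ρ * (x - 2 * t))) +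
        volterra (fun t => p t * qH p h t) ρ (fun t => Complex.cos (ρ * t)) x) := by
  have hparts := integral_mul_deriv_of_primitive hgi hpg (hasDerivAt_cos_mul_sub ρ x)
    (by fun_prop) hx
  have hsplit : ∀ t : ℝ, sinQuot ρ (x - t) * (p t * (ρ ^ 2 * Complex.cos (ρ * t) +
      ρ * (h + omega p t) * Complex.sin (ρ * t) + qH p h t * Complex.cos (ρ * t))) =
      (1 / 2) * (p t * (ρ * Complex.sin (ρ * (x - 2 * t)))) +
      ((1 / 2) * ρ * Complex.sin (ρ * x) - (1 / 2) * h * Complex.cos (ρ * x)) * p t +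
      (-(1 / 2) * Complex.cos (ρ * x)) * (p t * omega p t) +
      (1 / 2) * ((p t * (h + omega p t)) * Complex.cos (ρ * (x - 2 * t))) +
      sinQuot ρ (x - t) * (p t * qH p h t * Complex.cos (ρ * t)) := fun t => by
    obtain ⟨h1, h2⟩ := sinQuot_mul_split ρ x t
    linear_combination (ρ * p t) * h2 + p t * (h + omega p t) * h1
  have hi : ∀ {f : ℝ → ℂ}, Continuous f → IntervalIntegrable f volume 0 x :=
    fun hf => hf.intervalIntegrable _ _
  rw [volterra, volterra]
  simp only [hsplit]
  rw [intervalIntegral.integral_add (hi (by fun_prop)) (hi (by fun_prop)),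
    intervalIntegral.integral_add (hi (by fun_prop)) (hi (by fun_prop)),
    intervalIntegral.integral_add (hi (by fun_prop)) (hi (by fun_prop)),
    intervalIntegral.integral_add (hi (by fun_prop)) (hi (by fun_prop))]
  simp only [intervalIntegral.integral_const_mul]
  rw [hparts, integral_mul_omega hp, integral_eq_two_mul_omega (p := p)]
  have e1 : ρ * ((x : ℂ) - 2 * x) = -(ρ * x) := by ring
  have e2 : ∀ t : ℝ, g t * ((1 / 2) * Complex.cos (ρ * (x - 2 * t))) =
      (1 / 2) * (g t * Complex.cos (ρ * (x - 2 * t))) := fun t => by ring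
  simp only [e1, e2, Complex.cos_neg, Complex.ofReal_zero, mul_zero, sub_zero,
    intervalIntegral.integral_const_mul, qH]
  ring

/-- The remainder of the asymptotics of the sine-type solution. -/
theorem pwFamily_sine_remainder {L : ℝ} (hg : MemLp g 2 volume) {Y : ℂ → ℝ → ℂ}
    (hY : ∀ ρ, Continuous (Y ρ))
    (hv : ∀ ρ, ∀ x ∈ Set.Icc 0 L, Y ρ x = sinQuot ρ x + volterra p ρ (Y ρ) x) :
    PWFamily L fun ρ x => ρ ^ 3 * Y ρ x - (ρ ^ 2 * Complex.sin (ρ * x) -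
      ρ * omega p x * Complex.cos (ρ * x) + qPlus p x * Complex.sin (ρ * x)) := by
  have hA : ∀ ρ : ℂ, Continuous fun x : ℝ => ρ ^ 2 * Complex.sin (ρ * x) -
      ρ * omega p x * Complex.cos (ρ * x) + qPlus p x * Complex.sin (ρ * x) := fun ρ => by fun_prop
  have hF : ∀ ρ : ℂ, Continuous fun x : ℝ => ρ ^ 3 * Y ρ x - (ρ ^ 2 * Complex.sin (ρ * x) -
      ρ * omega p x * Complex.cos (ρ * x) + qPlus p x * Complex.sin (ρ * x)) :=
    fun ρ => (continuous_const.mul (hY ρ)).sub (hA ρ)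
  -- With main part `A`, the remainder solves the Volterra equation with free term `ρ² sin - A + V
  -- A`. There the growing terms cancel.
  refine PWFamily.of_volterra_eq (G := fun ρ x => ρ ^ 2 * Complex.sin (ρ * x) -
      (ρ ^ 2 * Complex.sin (ρ * x) -
        ρ * omega p x * Complex.cos (ρ * x) + qPlus p x * Complex.sin (ρ * x)) +
      volterra p ρ (fun x => ρ ^ 2 * Complex.sin (ρ * x) -
        ρ * omega p x * Complex.cos (ρ * x) + qPlus p x * Complex.sin (ρ * x)) x) hp hF
    (fun ρ => (Continuous.sub (by fun_prop) (hA ρ)).add (continuous_volterra hp (hA ρ)))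
    (fun ρ x hx => ?_) ?_
  · rw [add_assoc (_ - _), ← volterra_add hp (hA ρ) (hF ρ)]
    simp only [add_sub_cancel]
    rw [PWFamily.volterra_const_mul, hv ρ x hx, ← mul_sinQuot]
    ring
  · refine ((((PWFamily.integral_sin (hg.restrict (Set.Ioc 0 L))).const_mul (1 / 4)).add
      ((PWFamily.integral_sin (g := fun t => p t * omega p t)
        (memLp_two_of_continuous (by fun_prop) 0 L)).const_mul (-(1 / 2)))).add
      (PWFamily.volterra_sin (f := fun t => p t * qPlus p t) (by fun_prop))).congr
      fun ρ x hx => ?_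
    rw [volterra_sine_asymptotics hp hgi hpg ρ hx.1]
    ring

/-- The remainder of the asymptotics of the cosine-type solution. -/
theorem pwFamily_cosine_remainder {L : ℝ} (hg : MemLp g 2 volume) (h : ℂ) {Y : ℂ → ℝ → ℂ}
    (hY : ∀ ρ, Continuous (Y ρ))
    (hv : ∀ ρ, ∀ x ∈ Set.Icc 0 L,
      Y ρ x = Complex.cos (ρ * x) + h * sinQuot ρ x + volterra p ρ (Y ρ) x) :
    PWFamily L fun ρ x => ρ ^ 2 * Y ρ x - (ρ ^ 2 * Complex.cos (ρ * x) +
      ρ * (h + omega p x) * Complex.sin (ρ * x) + qH p h x * Complex.cos (ρ * x)) := by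
  have hA : ∀ ρ : ℂ, Continuous fun x : ℝ => ρ ^ 2 * Complex.cos (ρ * x) +
      ρ * (h + omega p x) * Complex.sin (ρ * x) + qH p h x * Complex.cos (ρ * x) :=
    fun ρ => by fun_prop
  have hF : ∀ ρ : ℂ, Continuous fun x : ℝ => ρ ^ 2 * Y ρ x - (ρ ^ 2 * Complex.cos (ρ * x) +
      ρ * (h + omega p x) * Complex.sin (ρ * x) + qH p h x * Complex.cos (ρ * x)) :=
    fun ρ => (continuous_const.mul (hY ρ)).sub (hA ρ)
  refine PWFamily.of_volterra_eq (G := fun ρ x =>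
      ρ ^ 2 * Complex.cos (ρ * x) + h * ρ * Complex.sin (ρ * x) -
      (ρ ^ 2 * Complex.cos (ρ * x) +
        ρ * (h + omega p x) * Complex.sin (ρ * x) + qH p h x * Complex.cos (ρ * x)) +
      volterra p ρ (fun x => ρ ^ 2 * Complex.cos (ρ * x) +
        ρ * (h + omega p x) * Complex.sin (ρ * x) + qH p h x * Complex.cos (ρ * x)) x) hp hF
    (fun ρ => (Continuous.sub (by fun_prop) (hA ρ)).add (continuous_volterra hp (hA ρ)))
    (fun ρ x hx => ?_) ?_
  · rw [add_assoc (_ - _), ← volterra_add hp (hA ρ) (hF ρ)]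
    simp only [add_sub_cancel]
    rw [PWFamily.volterra_const_mul, hv ρ x hx]
    linear_combination (-h * ρ) * (mul_sinQuot ρ x).symm
  · refine ((((PWFamily.integral_cos (hg.restrict (Set.Ioc 0 L))).const_mul (-(1 / 4))).add
      ((PWFamily.integral_cos (g := fun t => p t * (h + omega p t))
        (memLp_two_of_continuous (by fun_prop) 0 L)).const_mul (1 / 2))).add
      (PWFamily.volterra_cos (f := fun t => p t * qH p h t) (by fun_prop))).congr
      fun ρ x hx => ?_
    rw [volterra_cosine_asymptotics hp hgi hpg h ρ hx.1]
    ring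

end Potential

/-! ### The sampling kernels -/

section Kernels

theorem csinc_eq_sinQuot {x : ℝ} (hx : 0 < x) (ρ : ℂ) :
    csinc (ρ * x / Real.pi) = (x : ℂ)⁻¹ * sinQuot ρ x := by
  rw [← integral_exp_eq_csinc hx.ne', sinQuot, mul_inv]
  ring

theorem continuous_sinQuot_left (a : ℝ) : Continuous fun ρ => sinQuot ρ a := by
  unfold sinQuot
  refine continuous_const.mul
    (intervalIntegral.continuous_parametric_intervalIntegral_of_continuous' ?_ _ _)
  simp only [Function.uncurry_def]
  fun_prop

@[fun_prop]
theorem continuous_csinc : Continuous csinc := by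
  have h : csinc = fun z => sinQuot (Real.pi * z) 1 := by
    ext z
    have := csinc_eq_sinQuot one_pos (Real.pi * z)
    have hpi : (Real.pi : ℂ) ≠ 0 := by exact_mod_cast Real.pi_ne_zero
    rw [Complex.ofReal_one, mul_one, mul_div_cancel_left₀ _ hpi] at this
    simpa using this
  rw [h]
  exact (continuous_sinQuot_left 1).comp (continuous_const.mul continuous_id)

theorem csinc_neg (z : ℂ) : csinc (-z) = csinc z := by
  unfold csinc
  simp only [neg_eq_zero, mul_neg, Complex.sin_neg, neg_div_neg_eq]

theorem csinc_two_mul (z : ℂ) : csinc (2 * z) = csinc z * Complex.cos (Real.pi * z) := by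
  unfold csinc
  by_cases hz : z = 0
  · simp [hz]
  · have hpi : (Real.pi : ℂ) ≠ 0 := by exact_mod_cast Real.pi_ne_zero
    rw [if_neg hz, if_neg (by simpa using hz), show (Real.pi : ℂ) * (2 * z) = 2 * (Real.pi * z) by ring,
      Complex.sin_two_mul]
    field_simp

/-- The doubling formula splits off cosines at half-integer shifts, which equal `±(-1)^n sin(ρx)`.
The quotient by `2 sin(ρx)` is thus a difference of sincs at half-integer nodes, visibly continuous.
-/
theorem sKernel_eq (x : ℝ) (n : ℕ) (ρ : ℂ) :
    sKernel x n ρ = 2 * Complex.sin (ρ * x) * ((-1) ^ n / 2 *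
      (csinc (ρ * x / Real.pi - (2 * n + 1) / 2) - csinc (ρ * x / Real.pi + (2 * n + 1) / 2))) := by
  have hpi : (Real.pi : ℂ) ≠ 0 := by exact_mod_cast Real.pi_ne_zero
  have e1 : 2 * ρ * x / Real.pi - 2 * n - 1 = 2 * (ρ * x / Real.pi - (2 * n + 1) / 2) := by ring
  have e2 : 2 * ρ * x / Real.pi + 2 * n + 1 = 2 * (ρ * x / Real.pi + (2 * n + 1) / 2) := by ring
  have c1 : Complex.cos (Real.pi * (ρ * x / Real.pi - (2 * n + 1) / 2)) =
      (-1) ^ n * Complex.sin (ρ * x) := by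
    rw [show (Real.pi : ℂ) * (ρ * x / Real.pi - (2 * n + 1) / 2) =
      (ρ * x - n * Real.pi) - Real.pi / 2 by field_simp; ring, Complex.cos_sub_pi_div_two,
      Complex.sin_antiperiodic.sub_nat_mul_eq]
  have c2 : Complex.cos (Real.pi * (ρ * x / Real.pi + (2 * n + 1) / 2)) =
      -((-1) ^ n * Complex.sin (ρ * x)) := by
    rw [show (Real.pi : ℂ) * (ρ * x / Real.pi + (2 * n + 1) / 2) =
      (ρ * x + n * Real.pi) + Real.pi / 2 by field_simp; ring, Complex.cos_add_pi_div_two,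
      Complex.sin_antiperiodic.add_nat_mul_eq]
  rw [sKernel, e1, e2, csinc_two_mul, csinc_two_mul, c1, c2]
  ring

theorem eventually_sin_ne_zero {x : ℝ} (hx : 0 < x) (ρ : ℂ) :
    ∀ᶠ z in 𝓝[≠] ρ, Complex.sin (z * x) ≠ 0 := by
  by_cases h : Complex.sin (ρ * x) = 0
  · have hd : HasDerivAt (fun z : ℂ => Complex.sin (z * x)) (Complex.cos (ρ * x) * x) ρ := by
      simpa using ((hasDerivAt_id ρ).mul_const (x : ℂ)).csin
    refine hd.eventually_ne (mul_ne_zero (fun hc => ?_) (by exact_mod_cast hx.ne'))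
    have := Complex.sin_sq_add_cos_sq (ρ * x)
    simp [h, hc] at this
  · have hc : Continuous fun z : ℂ => Complex.sin (z * x) := by fun_prop
    exact (hc.continuousAt.eventually_ne h).filter_mono nhdsWithin_le_nhds

theorem sKernelQuot_eq {x : ℝ} (hx : 0 < x) (n : ℕ) (ρ : ℂ) :
    sKernelQuot x n ρ = (-1) ^ n / 2 *
      (csinc (ρ * x / Real.pi - (2 * n + 1) / 2) - csinc (ρ * x / Real.pi + (2 * n + 1) / 2)) := by
  refine Tendsto.limUnder_eq ?_
  have hc : Continuous fun ρ : ℂ => (-1) ^ n / 2 *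
      (csinc (ρ * x / Real.pi - (2 * n + 1) / 2) - csinc (ρ * x / Real.pi + (2 * n + 1) / 2)) := by
    fun_prop
  refine ((hc.tendsto ρ).mono_left nhdsWithin_le_nhds).congr' ?_
  filter_upwards [eventually_sin_ne_zero hx ρ] with z hz
  rw [sKernel_eq, mul_div_cancel_left₀ _ (by simpa using hz)]

theorem sKernel_eq_mul_sKernelQuot {x : ℝ} (hx : 0 < x) (n : ℕ) (ρ : ℂ) :
    sKernel x n ρ = 2 * Complex.sin (ρ * x) * sKernelQuot x n ρ := by
  rw [sKernelQuot_eq hx, sKernel_eq]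

end Kernels

/-! ### The remainders at a fixed point `x` -/

section Solutions

variable {L : ℝ} {q : ℝ → ℂ} {x : ℝ}

theorem PWBound.continuous [Fact (0 < 2 * x)] {C : ℝ} {f : ℂ → ℂ} (hf : PWBound C x f) :
    Continuous f := by
  obtain ⟨v, hv⟩ := hf.exists_inner
  rw [funext hv]
  exact continuous_inner_expL2 x v

theorem omega_congr {p : ℝ → ℂ} (hqp : ∀ x ∈ Set.Icc 0 L, q x = p x) (hx : x ∈ Set.Icc 0 L) :
    omega q x = omega p x := by
  unfold omega
  congr 1
  refine intervalIntegral.integral_congr fun t ht => ?_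
  rw [Set.uIcc_of_le hx.1] at ht
  exact hqp t ⟨ht.1, ht.2.trans hx.2⟩

theorem qPlus_congr {p : ℝ → ℂ} (hqp : ∀ x ∈ Set.Icc 0 L, q x = p x) (hx : x ∈ Set.Icc 0 L) :
    qPlus q x = qPlus p x := by
  rw [qPlus, qPlus, omega_congr hqp hx, hqp x hx, hqp 0 ⟨le_rfl, hx.1.trans hx.2⟩]

theorem qH_congr {p : ℝ → ℂ} (hqp : ∀ x ∈ Set.Icc 0 L, q x = p x) (h : ℂ) (hx : x ∈ Set.Icc 0 L) :
    qH q h x = qH p h x := by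
  rw [qH, qH, omega_congr hqp hx, hqp x hx, hqp 0 ⟨le_rfl, hx.1.trans hx.2⟩]

/-- Solution minus free part is Paley–Wiener, hence continuous in `ρ`. This yields the limits at `ρ
= 0`. -/
theorem IsSolution.continuous_in_parameter (hL : 0 ≤ L) (hq : MemW21 L q) {a b : ℂ}
    {S : ℂ → ℝ → ℂ} (hS : ∀ ρ, IsSolution L q ρ a b (S ρ)) (hx : x ∈ Set.Ioc 0 L) :
    Continuous fun ρ => S ρ x := by
  have : Fact (0 < 2 * x) := ⟨by linarith [hx.1]⟩
  have hx' := Set.Ioc_subset_Icc_self hx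
  obtain ⟨p, g, -, -, hp, -, hqp⟩ := hq.exists_extension
  obtain ⟨Y, hY, hSY, hv⟩ := exists_continuous_solution hL hp hqp hS
  obtain ⟨C, -, hC⟩ := pwFamily_solution_sub_free hp hY hv
  have h1 := (hC x hx').continuous
  have h2 : Continuous fun ρ : ℂ => a * Complex.cos (ρ * x) + b * sinQuot ρ x :=
    (by fun_prop : Continuous fun ρ : ℂ => a * Complex.cos (ρ * x)).add
      (continuous_const.mul (continuous_sinQuot_left x))
  refine (h1.add h2).congr fun ρ => ?_
  rw [hSY ρ x hx']
  exact sub_add_cancel _ _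

theorem IsSolution.apply_neg (hL : 0 ≤ L) (hq : MemW21 L q) {a b : ℂ}
    {S : ℂ → ℝ → ℂ} (hS : ∀ ρ, IsSolution L q ρ a b (S ρ)) (hx : x ∈ Set.Icc 0 L) (ρ : ℂ) :
    S (-ρ) x = S ρ x := by
  obtain ⟨p, g, -, -, hp, -, hqp⟩ := hq.exists_extension
  obtain ⟨Y, hY, hSY, hv⟩ := exists_continuous_solution hL hp hqp hS
  rw [hSY _ x hx, hSY _ x hx, solution_neg hp hY hv ρ hx]

theorem pwBound_sine (hL : 0 ≤ L) (hq : MemW21 L q) {S : ℂ → ℝ → ℂ}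
    (hS : ∀ ρ, IsSolution L q ρ 0 1 (S ρ)) (hx : x ∈ Set.Icc 0 L) :
    ∃ C, PWBound C x fun ρ => ρ ^ 3 * S ρ x - (ρ ^ 2 * Complex.sin (ρ * x) -
      ρ * omega q x * Complex.cos (ρ * x) + qPlus q x * Complex.sin (ρ * x)) := by
  obtain ⟨p, g, hg, hgi, hp, hpg, hqp⟩ := hq.exists_extension
  obtain ⟨Y, hY, hSY, hv⟩ := exists_continuous_solution hL hp hqp hS
  simp only [zero_mul, one_mul, zero_add] at hv
  obtain ⟨C, -, hC⟩ := pwFamily_sine_remainder hp hgi hpg hg hY hv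
  refine ⟨C, ?_⟩
  simp only [hSY _ x hx, omega_congr hqp hx, qPlus_congr hqp hx]
  exact hC x hx

/-- Subtracting the sinc, itself Paley–Wiener, makes the remainder vanish at `ρ = 0`, so the series
needs no term `n = 0`. The difference `cos - sinc` is the source of the `j₁` term. -/
theorem pwBound_cosine (hL : 0 ≤ L) (hq : MemW21 L q) {h : ℂ} {φ : ℂ → ℝ → ℂ}
    (hφ : ∀ ρ, IsSolution L q ρ 1 h (φ ρ)) (hx : x ∈ Set.Ioc 0 L) :
    ∃ C, PWBound C x fun ρ => ρ ^ 2 * (Complex.cos (ρ * x) - φ ρ x) +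
      ρ * (h + omega q x) * Complex.sin (ρ * x) +
      qH q h x * (Complex.cos (ρ * x) - csinc (ρ * x / Real.pi)) := by
  have hx' := Set.Ioc_subset_Icc_self hx
  obtain ⟨p, g, hg, hgi, hp, hpg, hqp⟩ := hq.exists_extension
  obtain ⟨Y, hY, hSY, hv⟩ := exists_continuous_solution hL hp hqp hφ
  simp only [one_mul] at hv
  obtain ⟨C, -, hC⟩ := (pwFamily_cosine_remainder hp hgi hpg hg h hY hv)
  obtain ⟨C', -, hC'⟩ := PWFamily.sinQuot (L := L)
  have hb := ((hC x hx').const_mul (-1)).add ((hC' x hx').const_mul (-(qH q h x * (x : ℂ)⁻¹)))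
  refine ⟨‖(-1 : ℂ)‖ * C + ‖-(qH q h x * (x : ℂ)⁻¹)‖ * C', ?_⟩
  convert! hb using 2 with ρ
  rw [csinc_eq_sinQuot hx.1, hSY _ x hx', omega_congr hqp hx', qH_congr hqp h hx']
  ring

end Solutions

/-! ### Identification of the sampling series -/

section Series

variable {L : ℝ} {q : ℝ → ℂ} {x : ℝ}

/-- At the nodes `cos(ρx) = 0` and `sin(ρx) = (-1)^n`, so the coefficient is a multiple of the
sampled remainder. -/
theorem sCoeff_eq (hx : 0 < x) (S : ℂ → ℝ → ℂ) (n : ℕ) {ρ : ℂ}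
    (hρ : ρ = (2 * n + 1) / (2 * x) * Real.pi) :
    sCoeff q S x n = -2 * (-1) ^ n * (ρ ^ 3 * S ρ x - (ρ ^ 2 * Complex.sin (ρ * x) -
      ρ * omega q x * Complex.cos (ρ * x) + qPlus q x * Complex.sin (ρ * x))) := by
  have hx0 : (x : ℂ) ≠ 0 := by exact_mod_cast hx.ne'
  have e : ρ * x = n * Real.pi + Real.pi / 2 := by rw [hρ]; field_simp
  have hs : Complex.sin (ρ * x) = (-1) ^ n := by
    rw [e, Complex.sin_add_pi_div_two]
    simpa using Complex.cos_antiperiodic.add_nat_mul_eq (x := 0) n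
  have hc : Complex.cos (ρ * x) = 0 := by
    rw [e, Complex.cos_add_pi_div_two, Complex.sin_nat_mul_pi, neg_zero]
  have h1 : ((-1 : ℂ) ^ n) * (-1) ^ n = 1 := by rw [← mul_pow]; simp
  have h3 : ((2 * (n : ℂ) + 1) * Real.pi) ^ 3 / (4 * x ^ 3) = 2 * ρ ^ 3 := by
    rw [hρ]; field_simp; ring
  rw [sCoeff, ← hρ, h3, hs, hc, pow_succ]
  linear_combination (-2 * ρ ^ 2 - 2 * qPlus q x) * h1

theorem phiCoeff_eq (hx : 0 < x) (h : ℂ) (φ : ℂ → ℝ → ℂ) (n : ℕ) {ρ : ℂ}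
    (hρ : ρ = ((n + 1 : ℕ) : ℂ) * Real.pi / x) :
    phiCoeff q h φ x (n + 1) = ρ ^ 2 * (Complex.cos (ρ * x) - φ ρ x) +
      ρ * (h + omega q x) * Complex.sin (ρ * x) +
      qH q h x * (Complex.cos (ρ * x) - csinc (ρ * x / Real.pi)) := by
  have hx0 : (x : ℂ) ≠ 0 := by exact_mod_cast hx.ne'
  have hpi : (Real.pi : ℂ) ≠ 0 := by exact_mod_cast Real.pi_ne_zero
  have e : ρ * x = (n + 1 : ℕ) * Real.pi := by rw [hρ]; field_simp
  have hc : Complex.cos (ρ * x) = (-1) ^ (n + 1) := by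
    rw [e]
    simpa using Complex.cos_antiperiodic.add_nat_mul_eq (x := 0) (n + 1)
  have hs : Complex.sin (ρ * x) = 0 := by rw [e, Complex.sin_nat_mul_pi]
  have hcs : csinc (ρ * x / Real.pi) = 0 := by
    rw [e, mul_div_cancel_right₀ _ hpi]
    have := csinc_intCast (n + 1 : ℕ)
    rw [if_neg (by positivity)] at this
    exact_mod_cast this
  rw [phiCoeff, ← hρ, hc, hs, hcs]
  ring

/-- The multiplier `m` covers both forms of the series: `m = 1` for the termwise quotient, `m = 2
sin(ρx)` for the original kernel. -/
theorem sine_series (hL : 0 ≤ L) (hq : MemW21 L q) {S : ℂ → ℝ → ℂ}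
    (hS : ∀ ρ, IsSolution L q ρ 0 1 (S ρ)) (hx : x ∈ Set.Ioc 0 L) {m : ℂ → ℂ} (hm : Continuous m)
    {B : ℝ} (hB : ∀ ρ : ℝ, ‖m ρ‖ ≤ B) :
    (∀ ρ, ∑' n, m ρ * (sCoeff q S x n * sKernelQuot x n ρ) =
      -m ρ * (ρ ^ 3 * S ρ x - (ρ ^ 2 * Complex.sin (ρ * x) -
        ρ * omega q x * Complex.cos (ρ * x) + qPlus q x * Complex.sin (ρ * x)))) ∧
    ConvergesLikeCardinalSeries fun n ρ => m ρ * (sCoeff q S x n * sKernelQuot x n ρ) := by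
  have : Fact (0 < 2 * x) := ⟨by linarith [hx.1]⟩
  have hx0 : (x : ℂ) ≠ 0 := by exact_mod_cast hx.1.ne'
  have hpi : (Real.pi : ℂ) ≠ 0 := by exact_mod_cast Real.pi_ne_zero
  have hx' := Set.Ioc_subset_Icc_self hx
  set R : ℂ → ℂ := fun ρ => ρ ^ 3 * S ρ x - (ρ ^ 2 * Complex.sin (ρ * x) -
        ρ * omega q x * Complex.cos (ρ * x) + qPlus q x * Complex.sin (ρ * x)) with hR
  have hodd : ∀ ρ, R (-ρ) = -R ρ := fun ρ => by
    simp only [hR, IsSolution.apply_neg hL hq hS hx' ρ, neg_mul, Complex.sin_neg, Complex.cos_neg]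
    ring
  obtain ⟨C, hC⟩ := pwBound_sine hL hq hS hx'
  -- The shift by half a step moves the half-integer nodes onto the lattice of the Fourier basis.
  obtain ⟨v, hv⟩ := (hC.comp_add (Real.pi / (2 * x))).exists_inner
  have hv' : ∀ ρ, ⟪v, expL2 x ρ⟫_ℂ = R (ρ + (Real.pi / (2 * x) : ℝ)) := fun ρ => (hv ρ).symm
  -- After the shift, `n` and `-(n+1)` label opposite nodes, which combine by oddness. The sign
  -- matches the factor `-2 * (-1)^n` in `sCoeff_eq`.
  have hsum := (hasSum_sampleTerm v).nat_add_neg_add_one.neg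
  have hterm : ∀ (n : ℕ) (ρ : ℂ), sCoeff q S x n * sKernelQuot x n ρ =
      ⟪-(sampleTerm x v n + sampleTerm x v (-(n + 1 : ℤ))),
        expL2 x (ρ + (-(Real.pi / (2 * x)) : ℝ))⟫_ℂ := fun n ρ => by
    have e1 : ((n : ℤ) : ℂ) * (Real.pi / x : ℝ) + (Real.pi / (2 * x) : ℝ) =
        (2 * n + 1) / (2 * x) * Real.pi := by push_cast; field_simp
    have e2 : ((-(n + 1 : ℤ) : ℤ) : ℂ) * (Real.pi / x : ℝ) + (Real.pi / (2 * x) : ℝ) =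
        -((2 * n + 1) / (2 * x) * Real.pi) := by push_cast; field_simp; ring
    have e3 : (ρ + (-(Real.pi / (2 * x)) : ℝ)) * x / Real.pi - (n : ℤ) =
        ρ * x / Real.pi - (2 * n + 1) / 2 := by push_cast; field_simp; ring
    have e4 : (ρ + (-(Real.pi / (2 * x)) : ℝ)) * x / Real.pi - (-(n + 1 : ℤ) : ℤ) =
        ρ * x / Real.pi + (2 * n + 1) / 2 := by push_cast; field_simp; ring
    have h1 : ((-1 : ℂ) ^ n) * (-1) ^ n = 1 := by rw [← mul_pow]; simp
    rw [inner_neg_left, inner_add_left, inner_sampleTerm, inner_sampleTerm, hv', hv', e1, e2, e3, e4,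
      hodd, sCoeff_eq hx.1 S n rfl, sKernelQuot_eq hx.1]
    simp only [hR]
    linear_combination (-(R ((2 * n + 1) / (2 * x) * Real.pi)) *
      (csinc (ρ * x / Real.pi - (2 * n + 1) / 2) - csinc (ρ * x / Real.pi + (2 * n + 1) / 2))) * h1
  obtain ⟨h1, h2⟩ := convergesLikeCardinalSeries_of_hasSum hm hB (-(Real.pi / (2 * x))) hsum
    (f := fun n ρ => m ρ * (sCoeff q S x n * sKernelQuot x n ρ)) fun n ρ => by rw [hterm]
  refine ⟨fun ρ => ?_, h2⟩
  rw [(h1 ρ).tsum_eq, inner_neg_left, hv']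
  push_cast
  rw [neg_add_cancel_right]
  ring

theorem cosine_series (hL : 0 ≤ L) (hq : MemW21 L q) {h : ℂ} {φ : ℂ → ℝ → ℂ}
    (hφ : ∀ ρ, IsSolution L q ρ 1 h (φ ρ)) (hx : x ∈ Set.Ioc 0 L) :
    (∀ ρ, ∑' n, phiCoeff q h φ x (n + 1) * phiKernel x (n + 1) ρ =
      ρ ^ 2 * (Complex.cos (ρ * x) - φ ρ x) +
      ρ * (h + omega q x) * Complex.sin (ρ * x) +
      qH q h x * (Complex.cos (ρ * x) - csinc (ρ * x / Real.pi))) ∧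
    ConvergesLikeCardinalSeries fun n ρ => phiCoeff q h φ x (n + 1) * phiKernel x (n + 1) ρ := by
  have : Fact (0 < 2 * x) := ⟨by linarith [hx.1]⟩
  have hx0 : (x : ℂ) ≠ 0 := by exact_mod_cast hx.1.ne'
  have hpi : (Real.pi : ℂ) ≠ 0 := by exact_mod_cast Real.pi_ne_zero
  have hx' := Set.Ioc_subset_Icc_self hx
  set G : ℂ → ℂ := fun ρ => ρ ^ 2 * (Complex.cos (ρ * x) - φ ρ x) +
      ρ * (h + omega q x) * Complex.sin (ρ * x) +
      qH q h x * (Complex.cos (ρ * x) - csinc (ρ * x / Real.pi)) with hG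
  have heven : ∀ ρ, G (-ρ) = G ρ := fun ρ => by
    simp only [hG, IsSolution.apply_neg hL hq hφ hx' ρ, neg_mul, Complex.sin_neg, Complex.cos_neg,
      neg_div, csinc_neg]
    ring
  obtain ⟨C, hC⟩ := pwBound_cosine hL hq hφ hx
  obtain ⟨v, hv⟩ := hC.exists_inner
  have hv' : ∀ ρ, ⟪v, expL2 x ρ⟫_ℂ = G ρ := fun ρ => (hv ρ).symm
  have hzero : sampleTerm x v 0 = 0 := by
    have h0 : ⟪expL2 x 0, v⟫_ℂ = 0 := by
      rw [← inner_conj_symm, hv']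
      simp [hG, csinc]
    simp [sampleTerm, h0]
  -- Pairing `n` with `-n` counts the index `0` twice, harmlessly since its sample vanishes; it is
  -- then dropped.
  have hsum : HasSum (fun n : ℕ => sampleTerm x v (n + 1 : ℕ) + sampleTerm x v (-(n + 1 : ℕ))) v := by
    have h1 := (hasSum_sampleTerm v).nat_add_neg
    rw [hzero, add_zero] at h1
    rw [← hasSum_nat_add_iff' 1] at h1
    simpa [hzero] using h1
  have hterm : ∀ (n : ℕ) (ρ : ℂ), phiCoeff q h φ x (n + 1) * phiKernel x (n + 1) ρ =
      1 * ⟪sampleTerm x v (n + 1 : ℕ) + sampleTerm x v (-(n + 1 : ℕ)),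
        expL2 x (ρ + (0 : ℝ))⟫_ℂ := fun n ρ => by
    have e1 : (((n + 1 : ℕ) : ℤ) : ℂ) * (Real.pi / x : ℝ) = ((n + 1 : ℕ) : ℂ) * Real.pi / x := by
      push_cast; ring
    have e2 : ((-((n + 1 : ℕ) : ℤ) : ℤ) : ℂ) * (Real.pi / x : ℝ) =
        -(((n + 1 : ℕ) : ℂ) * Real.pi / x) := by
      push_cast; ring
    rw [Complex.ofReal_zero, add_zero, inner_add_left, inner_sampleTerm, inner_sampleTerm, hv', hv',
      e1, e2, heven, phiCoeff_eq hx.1 h φ n rfl, phiKernel]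
    simp only [hG]
    push_cast
    ring_nf
  obtain ⟨h1, h2⟩ := convergesLikeCardinalSeries_of_hasSum (m := fun _ => 1) continuous_const
    (B := 1) (fun _ => by simp) 0 hsum hterm
  refine ⟨fun ρ => ?_, h2⟩
  rw [(h1 ρ).tsum_eq, hv', one_mul, Complex.ofReal_zero, add_zero]

end Series

end SincSL

end

/-! ### The representation theorem -/

theorem mainTheorem2 (L : ℝ) (hL : 0 < L) (q : ℝ → ℂ) (hq : SincSL.MemW21 L q) (h : ℂ)
    (S φ : ℂ → ℝ → ℂ)
    (hS : ∀ ρ : ℂ, SincSL.IsSolution L q ρ 0 1 (S ρ))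
    (hφ : ∀ ρ : ℂ, SincSL.IsSolution L q ρ 1 h (φ ρ))
    (x : ℝ) (hx : x ∈ Set.Ioc 0 L) :
    -- representation of `S`, and its limits at the zeros of `sin (ρ x)` and at `ρ = 0`
    (∀ ρ : ℂ, ρ ≠ 0 → Complex.sin (ρ * x) ≠ 0 → S ρ x = SincSL.sSeries q S x ρ) ∧
    (∀ ρ : ℂ, ρ ≠ 0 → S ρ x = SincSL.sSeriesFilled q S x ρ) ∧
    Tendsto (fun ρ : ℂ => SincSL.sSeries q S x ρ) (𝓝[≠] 0) (𝓝 (S 0 x)) ∧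
    -- representation of `φ`, and its limit at `ρ = 0`
    (∀ ρ : ℂ, ρ ≠ 0 → φ ρ x = SincSL.phiSeries q h φ x ρ) ∧
    Tendsto (fun ρ : ℂ => SincSL.phiSeries q h φ x ρ) (𝓝[≠] 0) (𝓝 (φ 0 x)) ∧
    -- convergence of the series
    SincSL.ConvergesLikeCardinalSeries
      (fun n ρ => SincSL.sCoeff q S x n * SincSL.sKernel x n ρ) ∧
    SincSL.ConvergesLikeCardinalSeries
      (fun n ρ => SincSL.sCoeff q S x n * SincSL.sKernelQuot x n ρ) ∧
    SincSL.ConvergesLikeCardinalSeries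
      (fun n ρ => SincSL.phiCoeff q h φ x (n + 1) * SincSL.phiKernel x (n + 1) ρ) := by
  have hx0 : (x : ℂ) ≠ 0 := by exact_mod_cast hx.1.ne'
  have hpi : (Real.pi : ℂ) ≠ 0 := by exact_mod_cast Real.pi_ne_zero
  obtain ⟨hsumQ, hconvQ⟩ := SincSL.sine_series hL.le hq hS hx (m := fun _ => 1) continuous_const
    (B := 1) fun _ => by simp
  obtain ⟨hsumS, hconvS⟩ := SincSL.sine_series hL.le hq hS hx
    (m := fun ρ : ℂ => 2 * Complex.sin (ρ * x)) (by fun_prop) (B := 2) fun ρ => by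
      rw [← Complex.ofReal_mul, ← Complex.ofReal_sin, norm_mul, Complex.norm_real, Real.norm_eq_abs,
        Complex.norm_two]
      linarith [Real.abs_sin_le_one (ρ * x)]
  obtain ⟨hsumφ, hconvφ⟩ := SincSL.cosine_series hL.le hq hφ hx
  have hker : ∀ (n : ℕ) (ρ : ℂ), 2 * Complex.sin (ρ * x) *
      (SincSL.sCoeff q S x n * SincSL.sKernelQuot x n ρ) =
      SincSL.sCoeff q S x n * SincSL.sKernel x n ρ := fun n ρ => by
    rw [SincSL.sKernel_eq_mul_sKernelQuot hx.1]
    ring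
  simp only [hker] at hsumS hconvS
  simp only [one_mul] at hsumQ hconvQ
  have hrepS : ∀ ρ : ℂ, ρ ≠ 0 → Complex.sin (ρ * x) ≠ 0 → S ρ x = SincSL.sSeries q S x ρ := by
    intro ρ hρ hs
    rw [SincSL.sSeries, hsumS]
    field_simp
    ring
  have hrepφ : ∀ ρ : ℂ, ρ ≠ 0 → φ ρ x = SincSL.phiSeries q h φ x ρ := by
    intro ρ hρ
    have h0 : ρ * x / Real.pi ≠ 0 := by positivity
    rw [SincSL.phiSeries, hsumφ, SincSL.sphericalJ1, SincSL.csinc, if_neg h0,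
      mul_div_cancel₀ _ hpi]
    field_simp
    ring
  refine ⟨hrepS, fun ρ hρ => ?_, ?_, hrepφ, ?_, hconvS, hconvQ, hconvφ⟩
  · rw [SincSL.sSeriesFilled, hsumQ]
    field_simp
    ring
  · refine (((SincSL.IsSolution.continuous_in_parameter hL.le hq hS hx).tendsto 0).mono_left
      nhdsWithin_le_nhds).congr' ?_
    filter_upwards [SincSL.eventually_sin_ne_zero hx.1 0, self_mem_nhdsWithin] with ρ hs hρ
    exact hrepS ρ hρ hs
  · refine (((SincSL.IsSolution.continuous_in_parameter hL.le hq hφ hx).tendsto 0).mono_left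
      nhdsWithin_le_nhds).congr' ?_
    filter_upwards [self_mem_nhdsWithin] with ρ hρ
    exact hrepφ ρ hρ
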